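/- **Setting.** Let $p$ be an odd prime and $\varepsilon\in\mathbb Z$ a non-square modulo $p$. Let $K$ be an imaginary quadratic field in which $p$ is inert, let $f\ge 1$ be an integer prime to $p$, and let $\mathcal O_c=\mathbb Z+c\,\mathcal O_K$ be the order of conductor $c$. Write $\widehat A=A\otimes_{\mathbb Z}\prod_q\mathbb Z_q$ for a ring $A$. In $M_2(\mathbb Z_p)$, with matrices $\left(\begin{smallmatrix}a&b\\c&d\end{smallmatrix}\right)$ and congruences modulo $p$, let $$M_{ns}=\{a\equiv d,\ b\varepsilon\equiv c\},\quad M_{ns+}=M_{ns}\cup\{a\equiv -d,\ -b\varepsilon\equiv c\},\quad M_s=\{b\equiv c\equiv 0\},\quad M_{s+}=M_s\cup\{a\equiv d\equiv 0\}.$$ Let $B$ be a quaternion algebra over $\mathbb Q$ with a fixed isomorphism $B\otimes\mathbb R\simeq M_2(\mathbb R)$, and let $R\subset B$ be an order with a fixed isomorphism $R_p=R\otimes\mathbb Z_p\simeq M_2(\mathbb Z_p)$. For $?\in\{ns,ns+,s,s+\}$ put $R_?=\{x\in R: x_p\in M_?\}$, let $\widehat R_?^\times$ be the group of invertible elements $x$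 of $\widehat R$ with $x_p\in M_?$, and put $\Gamma_?=\widehat R_?^\times\cap B^1$, where $B^1$ is the group of elements of reduced norm $1$. Let $$X_?(\mathbb C)=B^\times\backslash(\mathbb C-\mathbb R)\times\widehat B^\times/\widehat R_?^\times\ \cup\ \{\text{cusps}\},$$ where $B^\times$ acts by Möbius transformations on $\mathbb C-\mathbb R$ and by left multiplication on $\widehat B^\times$. Write $[z,\hat b]$ for the class of $(z,\hat b)$, and map $\Gamma_?\backslash\mathcal H^*$ to $X_?(\mathbb C)$ by $[z]\mapsto[z,1]$. The correspondence $\Gamma_{s+}\cdot1\cdot\Gamma_{ns+}$ maps $[z]\in\Gamma_{ns+}\backslash\mathcal H^*$ to the divisor $\sum_\alpha[\alpha z]$ on $\Gamma_{s+}\backslash\mathcal H^*$, the sum being over the right cosets $\Gamma_{s+}\alpha$ contained in $\Gamma_{s+}\Gamma_{ns+}$. Divisors on $\Gamma_{s+}\backslash\mathcal H^*$ are viewed as divisors on $X_{s+}$ through the map $[z]\mapsto[z,1]$. Let $\iota:K\to B$ be an embedding with $\iota(K)\cap R_{ns}=\iota(\mathcal O_f)$ and $\iota(K)\cap R_s=\iota(\mathcal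 O_{pf})$. Write $\mathcal O_f=\mathbb Z+\mathbb Z\omega_f$ and let $z_0$ be the fixed point of $\iota(\omega_f)$ in the upper half plane. Let $Q_f=[z_0,1]\in X_{ns}$ and $Q_{pf}=[z_0,1]\in X_s$. The images of these points in $X_{ns+}$ and $X_{s+}$ are denoted in the same way; $Q_f\in X_{ns+}$ corresponds to $[z_0]\in\Gamma_{ns+}\backslash\mathcal H^*$. Let $H_f\subset H_{pf}$ be the ring class fields of $K$ of conductors $f$ and $pf$, so that the Artin map identifies $\mathrm{Gal}(H_c/K)$ with $\widehat K^\times/K^\times\widehat{\mathcal O}_c^\times$ for $c\in\{f,pf\}$. For $\sigma\in\mathrm{Gal}(H_{pf}/K)$ let $Q_{pf}^\sigma=[z_0,\hat\iota(\mathfrak a)]$, where $\mathfrak a\in\widehat K^\times$ is any idele whose image under the Artin map is $\sigma$. **Proposition.** The points $Q_{pf}^\sigma\in X_s$, for $\sigma\in\mathrm{Gal}(H_{pf}/K)$, are well defined, and the identity $$2(\Gamma_{s+}\cdot1\cdot\Gamma_{ns+})\,Q_f=[\mathcal O_f^\times:\mathcal O_{pf}^\times]\sum_{\sigma\in\mathrm{Gal}(H_{pf}/H_f)}Q_{pf}^\sigma$$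 holds in $\mathrm{Div}(X_{s+})$. In particular, if $\mathcal O_f^\times=\{\pm1\}$, then $$2(\Gamma_{s+}\cdot1\cdot\Gamma_{ns+})\,Q_f=\sum_{\sigma\in\mathrm{Gal}(H_{pf}/H_f)}Q_{pf}^\sigma .$$ -/

import Mathlib

open scoped TensorProduct Pointwise

noncomputable section

namespace CartanCM

/-! ### Profinite completions of `ℤ`-modules -/

instance instFactPrimes (q : Nat.Primes) : Fact (q : ℕ).Prime := ⟨q.2⟩

/-- The ring `Ẑ = ∏_q ℤ_q`. -/
abbrev Zhat : Type := ∀ q : Nat.Primes, ℤ_[q]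

/-- `Â = Ẑ ⊗_ℤ A`. -/
abbrev Hat (A : Type*) [Ring A] : Type _ := Zhat ⊗[ℤ] A

section Hat
variable {A A' : Type*} [Ring A] [Ring A']

/-- The diagonal map `A → Â`. -/
def toHat (A : Type*) [Ring A] : A →+* Hat A :=
  (Algebra.TensorProduct.includeRight : A →ₐ[ℤ] Hat A).toRingHom

/-- The map `ĝ : Â → Â'` induced by a ring homomorphism `g : A → A'`. -/
def hatMap (g : A →+* A') : Hat A →+* Hat A' :=
  (Algebra.TensorProduct.map (AlgHom.id ℤ Zhat) g.toIntAlgHom).toRingHom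

/-- `Ŝ ⊆ Â`, for a subring `S` of `A`. -/
def hatSubring (S : Subring A) : Subring (Hat A) := (hatMap S.subtype).range

/-- The projection `x ↦ x_p` from `Â` to `A_p = ℤ_p ⊗_ℤ A`. -/
def toLocal (p : ℕ) [hp : Fact p.Prime] (A : Type*) [Ring A] : Hat A →+* ℤ_[p] ⊗[ℤ] A :=
  (Algebra.TensorProduct.map
    ((Pi.evalRingHom (fun q : Nat.Primes => ℤ_[q]) ⟨p, hp.out⟩).toIntAlgHom :
      Zhat →ₐ[ℤ] ℤ_[p])
    (AlgHom.id ℤ A)).toRingHom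

end Hat

/-! ### Cartan orders and their normalizers -/

section Cartan
variable (p : ℕ) [Fact p.Prime] (ε : ℤ)

/-- `M_ns`: the matrices `(a, b; c, d)` over `ℤ_p` with `a ≡ d` and `b ε ≡ c` modulo `p`. -/
def Mns : Submonoid (Matrix (Fin 2) (Fin 2) ℤ_[p]) where
  carrier := {m | (m 0 0).toZMod = (m 1 1).toZMod ∧
    (m 0 1).toZMod * (ε : ZMod p) = (m 1 0).toZMod}
  one_mem' := by simp
  mul_mem' := by
    rintro m n ⟨h1, h2⟩ ⟨h3, h4⟩
    simp only [Set.mem_ofPred_eq, Matrix.mul_apply, Fin.sum_univ_two, map_add, map_mul,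
      ← h2, ← h4, h1, h3]
    constructor <;> ring

/-- `M_ns+`: the union of `M_ns` and of the matrices with `a ≡ -d` and `-b ε ≡ c`. -/
def MnsPlus : Submonoid (Matrix (Fin 2) (Fin 2) ℤ_[p]) where
  carrier := {m | ((m 0 0).toZMod = (m 1 1).toZMod ∧
      (m 0 1).toZMod * (ε : ZMod p) = (m 1 0).toZMod) ∨
    ((m 0 0).toZMod = -(m 1 1).toZMod ∧
      -(m 0 1).toZMod * (ε : ZMod p) = (m 1 0).toZMod)}
  one_mem' := by simp
  mul_mem' := by
    rintro m n (⟨h1, h2⟩ | ⟨h1, h2⟩) (⟨h3, h4⟩ | ⟨h3, h4⟩)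
    · left
      simp only [Matrix.mul_apply, Fin.sum_univ_two, map_add, map_mul, ← h2, ← h4, h1, h3]
      constructor <;> ring
    · right
      simp only [Matrix.mul_apply, Fin.sum_univ_two, map_add, map_mul, ← h2, ← h4, h1, h3]
      constructor <;> ring
    · right
      simp only [Matrix.mul_apply, Fin.sum_univ_two, map_add, map_mul, ← h2, ← h4, h1, h3]
      constructor <;> ring
    · left
      simp only [Matrix.mul_apply, Fin.sum_univ_two, map_add, map_mul, ← h2, ← h4, h1, h3]
      constructor <;> ring

/-- `M_s`: the matrices `(a, b; c, d)` over `ℤ_p` with `b ≡ c ≡ 0` modulo `p`. -/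
def Ms : Submonoid (Matrix (Fin 2) (Fin 2) ℤ_[p]) where
  carrier := {m | (m 0 1).toZMod = 0 ∧ (m 1 0).toZMod = 0}
  one_mem' := by simp
  mul_mem' := by
    rintro m n ⟨h1, h2⟩ ⟨h3, h4⟩
    simp [Matrix.mul_apply, Fin.sum_univ_two, h1, h2, h3, h4]

/-- `M_s+`: the union of `M_s` and of the matrices with `a ≡ d ≡ 0` modulo `p`. -/
def MsPlus : Submonoid (Matrix (Fin 2) (Fin 2) ℤ_[p]) where
  carrier := {m | ((m 0 1).toZMod = 0 ∧ (m 1 0).toZMod = 0) ∨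
    ((m 0 0).toZMod = 0 ∧ (m 1 1).toZMod = 0)}
  one_mem' := by simp
  mul_mem' := by
    rintro m n (⟨h1, h2⟩ | ⟨h1, h2⟩) (⟨h3, h4⟩ | ⟨h3, h4⟩) <;>
    simp [Matrix.mul_apply, Fin.sum_univ_two, h1, h2, h3, h4]

theorem Mns_le : Mns p ε ≤ MnsPlus p ε := fun _ h => Or.inl h

theorem Ms_le : Ms p ≤ MsPlus p := fun _ h => Or.inl h

end Cartan

/-! ### The levels `R_?` and `R̂_?ˣ` -/

section Level
variable {p : ℕ} [Fact p.Prime] {B : Type*} [Ring B] (R : Subring B)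
  (φ : ℤ_[p] ⊗[ℤ] R ≃ₐ[ℤ_[p]] Matrix (Fin 2) (Fin 2) ℤ_[p])
  (M : Submonoid (Matrix (Fin 2) (Fin 2) ℤ_[p]))

/-- `R_? = {x ∈ R : x_p ∈ M_?}`, where `R_p` is identified with `M₂(ℤ_p)` through `φ`. -/
def level : Set B := {x | ∃ r : R, (r : B) = x ∧ φ (1 ⊗ₜ[ℤ] r) ∈ M}

/-- `R̂_? = {x ∈ R̂ : x_p ∈ M_?}`, as a submonoid of `B̂`. -/
def hatLevel : Submonoid (Hat B) :=
  (M.comap ((φ : ℤ_[p] ⊗[ℤ] R →* Matrix (Fin 2) (Fin 2) ℤ_[p]).comp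
    (toLocal p R : Hat R →* ℤ_[p] ⊗[ℤ] R))).map (hatMap R.subtype : Hat R →* Hat B)

/-- `R̂_?ˣ`, as a subgroup of `B̂ˣ`. -/
def hatLevelUnits : Subgroup (Hat B)ˣ := (hatLevel R φ M).units

variable {M} in
theorem hatLevelUnits_mono {M' : Submonoid (Matrix (Fin 2) (Fin 2) ℤ_[p])} (h : M ≤ M') :
    hatLevelUnits R φ M ≤ hatLevelUnits R φ M' :=
  Submonoid.units_mono (Submonoid.monotone_map (Submonoid.monotone_comap h))

end Level

/-! ### The half planes and the cusps -/

/-- `ℂ - ℝ`. -/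
def NonReal : Type := {z : ℂ // z.im ≠ 0}

/-- The denominator of a Möbius transformation. -/
def moebDen (g : Matrix (Fin 2) (Fin 2) ℝ) (z : ℂ) : ℂ := (g 1 0 : ℂ) * z + (g 1 1 : ℂ)

/-- The Möbius transformation `z ↦ (a z + b) / (c z + d)`. -/
def moeb (g : Matrix (Fin 2) (Fin 2) ℝ) (z : ℂ) : ℂ :=
  ((g 0 0 : ℂ) * z + (g 0 1 : ℂ)) / moebDen g z

theorem moebDen_ne_zero (g : GL (Fin 2) ℝ) {z : ℂ} (hz : z.im ≠ 0) :
    moebDen (g : Matrix (Fin 2) (Fin 2) ℝ) z ≠ 0 := by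
  intro h
  have hdet : (g : Matrix (Fin 2) (Fin 2) ℝ).det ≠ 0 :=
    ((Matrix.isUnit_iff_isUnit_det _).1 g.isUnit).ne_zero
  rw [Matrix.det_fin_two] at hdet
  have him := congrArg Complex.im h
  have hre := congrArg Complex.re h
  simp [moebDen, hz] at him
  simp [moebDen, him] at hre
  simp [him, hre] at hdet

theorem moeb_im (g : GL (Fin 2) ℝ) {z : ℂ} (hz : z.im ≠ 0) :
    (moeb (g : Matrix (Fin 2) (Fin 2) ℝ) z).im =
      (g : Matrix (Fin 2) (Fin 2) ℝ).det * z.im /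
        Complex.normSq (moebDen (g : Matrix (Fin 2) (Fin 2) ℝ) z) := by
  have h := Complex.normSq_pos.2 (moebDen_ne_zero g hz)
  rw [moeb, Complex.div_im, Matrix.det_fin_two]
  field_simp
  simp [moebDen]
  ring

theorem moeb_mul (g h : GL (Fin 2) ℝ) {z : ℂ} (hz : z.im ≠ 0) :
    moeb ((g * h : GL (Fin 2) ℝ) : Matrix (Fin 2) (Fin 2) ℝ) z =
      moeb (g : Matrix (Fin 2) (Fin 2) ℝ) (moeb (h : Matrix (Fin 2) (Fin 2) ℝ) z) := by
  have h1 := moebDen_ne_zero h hz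
  obtain ⟨w, hw⟩ : ∃ w, w = moeb (h : Matrix (Fin 2) (Fin 2) ℝ) z := ⟨_, rfl⟩
  have h2 : w * moebDen (h : Matrix (Fin 2) (Fin 2) ℝ) z =
      ((h : Matrix (Fin 2) (Fin 2) ℝ) 0 0 : ℂ) * z + ((h : Matrix (Fin 2) (Fin 2) ℝ) 0 1 : ℂ) := by
    rw [hw, moeb, div_mul_cancel₀ _ h1]
  have hden : moebDen ((g * h : GL (Fin 2) ℝ) : Matrix (Fin 2) (Fin 2) ℝ) z =
      moebDen (g : Matrix (Fin 2) (Fin 2) ℝ) w * moebDen (h : Matrix (Fin 2) (Fin 2) ℝ) z := by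
    rw [moebDen, moebDen, add_mul, mul_assoc, h2]
    simp [Matrix.mul_apply, Fin.sum_univ_two, moebDen]
    ring
  have hnum : (((g * h : GL (Fin 2) ℝ) : Matrix (Fin 2) (Fin 2) ℝ) 0 0 : ℂ) * z +
      (((g * h : GL (Fin 2) ℝ) : Matrix (Fin 2) (Fin 2) ℝ) 0 1 : ℂ) =
      (((g : Matrix (Fin 2) (Fin 2) ℝ) 0 0 : ℂ) * w + ((g : Matrix (Fin 2) (Fin 2) ℝ) 0 1 : ℂ)) *
        moebDen (h : Matrix (Fin 2) (Fin 2) ℝ) z := by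
    rw [add_mul, mul_assoc, h2]
    simp [Matrix.mul_apply, Fin.sum_univ_two, moebDen]
    ring
  rw [← hw, moeb, moeb, hden, hnum, mul_div_mul_right _ _ h1]

instance : MulAction (GL (Fin 2) ℝ) NonReal where
  smul g z := ⟨moeb (g : Matrix (Fin 2) (Fin 2) ℝ) z.1, by
    rw [moeb_im g z.2]
    have hdet : (g : Matrix (Fin 2) (Fin 2) ℝ).det ≠ 0 :=
      ((Matrix.isUnit_iff_isUnit_det _).1 g.isUnit).ne_zero
    exact div_ne_zero (mul_ne_zero hdet z.2)
      (Complex.normSq_pos.2 (moebDen_ne_zero g z.2)).ne'⟩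
  one_smul z := Subtype.ext (by
    change moeb ((1 : GL (Fin 2) ℝ) : Matrix (Fin 2) (Fin 2) ℝ) z.1 = z.1
    simp [moeb, moebDen])
  mul_smul g h z := Subtype.ext (moeb_mul g h z.2)

section Shimura
variable {B : Type*} [Ring B] [Algebra ℚ B]
  (ψ : ℝ ⊗[ℚ] B ≃ₐ[ℝ] Matrix (Fin 2) (Fin 2) ℝ)

/-- The map `Bˣ → GL₂(ℝ)` given by the real splitting `ψ : B_∞ ≃ M₂(ℝ)`. -/
def toGL : Bˣ →* GL (Fin 2) ℝ :=
  Units.map ((ψ : ℝ ⊗[ℚ] B →* Matrix (Fin 2) (Fin 2) ℝ).comp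
    ((Algebra.TensorProduct.includeRight : B →ₐ[ℚ] ℝ ⊗[ℚ] B) : B →* ℝ ⊗[ℚ] B))

/-- The reduced norm of `b ∈ Bˣ`, computed in the splitting `ψ`. -/
def nrd : Bˣ →* ℝˣ := Matrix.GeneralLinearGroup.det.comp (toGL ψ)

/-- `B¹`, the group of elements of reduced norm `1`. -/
def normOne : Subgroup Bˣ := (nrd ψ).ker

/-- The set `ℙ¹(B)` of right ideals `0 ≠ I ≠ B`. For `B = M₂(ℚ)` it is `ℙ¹(ℚ)`: the line `ℓ ⊂ ℚ²`
corresponds to the ideal of all matrices with columns in `ℓ`. It is empty if `B` is a division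
algebra. -/
def RatLine (B : Type*) [Ring B] : Type _ := {I : Submodule Bᵐᵒᵖ B // I ≠ ⊥ ∧ I ≠ ⊤}

/-- `β • I = β I`, which is the action of `GL₂(ℚ)` on lines when `B = M₂(ℚ)`. -/
instance : MulAction Bˣ (RatLine B) where
  smul β I := ⟨β • I.1, by
    refine ⟨fun h => I.2.1 ?_, fun h => I.2.2 ?_⟩
    · rw [← inv_smul_smul β I.1, h]
      exact Submodule.map_bot _
    · rw [← inv_smul_smul β I.1, h]
      refine eq_top_iff.2 fun x _ => ?_
      rw [← inv_smul_smul β x]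
      exact Submodule.smul_mem_pointwise_smul _ _ _ trivial⟩
  one_smul I := Subtype.ext (one_smul _ I.1)
  mul_smul a b I := Subtype.ext (mul_smul a b I.1)

/-- The sign, in `{1, -1}`, of the reduced norm. -/
def nrdSign : Bˣ →* SignTypeˣ :=
  (Units.map ((signHom : ℝ →*₀ SignType) : ℝ →* SignType)).comp (nrd ψ)

/-- `ℂ - ℝ` together with its rational boundary points. Each of the two half planes has its own
copy of `ℙ¹(B)` on the boundary; the label `1` marks the upper half plane, `-1` the lower one. -/
def ExtPlanes (_ψ : ℝ ⊗[ℚ] B ≃ₐ[ℝ] Matrix (Fin 2) (Fin 2) ℝ) : Type _ :=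
  NonReal ⊕ (RatLine B × SignTypeˣ)

variable {ψ} in
/-- The point of `ExtPlanes ψ` given by a non-real number. -/
def ofNonReal (z : NonReal) : ExtPlanes ψ := Sum.inl z

/-- `Bˣ` acts on `ℂ - ℝ` by Möbius transformations, through `ψ`, and on boundary points through
the action on `ℙ¹(B)`; elements of negative norm interchange the two half planes. -/
instance : MulAction Bˣ (ExtPlanes ψ) where
  smul β x := Sum.map (fun z => toGL ψ β • z) (fun c => (β • c.1, nrdSign ψ β * c.2)) x
  one_smul x := by
    rcases x with z | c
    · exact congrArg Sum.inl (by simp)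
    · exact congrArg Sum.inr (by simp)
  mul_smul a b x := by
    rcases x with z | c
    · exact congrArg Sum.inl (by simp [mul_smul])
    · exact congrArg Sum.inr (by simp [mul_smul, mul_assoc])

/-- `ℋ*`: the upper half plane together with its rational boundary points. -/
def HStar : Type _ :=
  {x : ExtPlanes ψ // Sum.elim (fun z : NonReal => 0 < z.1.im) (fun c => c.2 = 1) x}

variable {ψ} in
/-- The point of `ℋ*` given by a point of the upper half plane. -/
def ofUpper (z : NonReal) (hz : 0 < z.1.im) : HStar ψ := ⟨ofNonReal z, hz⟩

/-- `B¹` acts on `ℋ*`. -/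
instance : MulAction (normOne ψ) (HStar ψ) where
  smul γ x := ⟨(γ : Bˣ) • x.1, by
    obtain ⟨γ, hγ⟩ := γ
    have hγ' : nrd ψ γ = 1 := hγ
    obtain ⟨z | c, hx⟩ := x
    · have hdet : (toGL ψ γ : Matrix (Fin 2) (Fin 2) ℝ).det = 1 := congrArg Units.val hγ'
      change 0 < (moeb (toGL ψ γ : Matrix (Fin 2) (Fin 2) ℝ) z.1).im
      rw [moeb_im _ z.2, hdet, one_mul]
      exact div_pos hx (Complex.normSq_pos.2 (moebDen_ne_zero _ z.2))
    · have hc : c.2 = 1 := hx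
      change nrdSign ψ γ * c.2 = 1
      simp [nrdSign, hγ', hc]⟩
  one_smul x := Subtype.ext (one_smul Bˣ x.1)
  mul_smul a b x := Subtype.ext (mul_smul (a : Bˣ) (b : Bˣ) x.1)

/-! ### Shimura curves -/

/-- Two pairs `(x, b)` and `(x', b')` are identified if `x' = β x` and `b' = β b u` with `β ∈ Bˣ` and
`u ∈ U`. -/
def shimuraSetoid (U : Subgroup (Hat B)ˣ) : Setoid (ExtPlanes ψ × (Hat B)ˣ) where
  r P P' := ∃ β : Bˣ, ∃ u ∈ U, P'.1 = β • P.1 ∧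
    P'.2 = Units.map (toHat B : B →* Hat B) β * P.2 * u
  iseqv :=
    { refl := fun P => ⟨1, 1, U.one_mem, by simp, by simp⟩
      symm := by
        rintro P P' ⟨β, u, hu, h1, h2⟩
        exact ⟨β⁻¹, u⁻¹, U.inv_mem hu, by simp [h1], by simp [h2, mul_assoc]⟩
      trans := by
        rintro P P' P'' ⟨β, u, hu, h1, h2⟩ ⟨β', u', hu', h3, h4⟩
        exact ⟨β' * β, u * u', U.mul_mem hu hu', by simp [h1, h3, mul_smul],
          by simp [h2, h4, mul_assoc]⟩ }

/-- The complex points `X_U(ℂ)` of the compactified Shimura curve of level `U`: the double quotient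
of `(ℂ - ℝ) × B̂ˣ` by `Bˣ` and `U`, together with the cusps. -/
def ShimuraCurve (U : Subgroup (Hat B)ˣ) : Type _ := Quotient (shimuraSetoid ψ U)

variable {ψ} in
/-- The class `[x, b]` in `X_U(ℂ)`. -/
def cls (U : Subgroup (Hat B)ˣ) (x : ExtPlanes ψ) (b : (Hat B)ˣ) : ShimuraCurve ψ U :=
  Quotient.mk (shimuraSetoid ψ U) (x, b)

/-- The natural projection `X_U → X_V` for `U ≤ V`. -/
def proj {U V : Subgroup (Hat B)ˣ} (h : U ≤ V) : ShimuraCurve ψ U → ShimuraCurve ψ V :=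
  Quotient.map' id (by
    rintro P P' ⟨β, u, hu, h1, h2⟩
    exact ⟨β, u, h hu, h1, h2⟩)

/-- The group `Γ = U ∩ B¹`. -/
def gam (U : Subgroup (Hat B)ˣ) : Subgroup (normOne ψ) :=
  U.comap ((Units.map (toHat B : B →* Hat B)).comp (normOne ψ).subtype)

/-- The map `Γ \ ℋ* → X_U(ℂ)`, `[x] ↦ [x, 1]`. -/
def unif (U : Subgroup (Hat B)ˣ) :
    MulAction.orbitRel.Quotient (gam ψ U) (HStar ψ) → ShimuraCurve ψ U :=
  Quotient.lift (fun x => cls U x.1 1) (by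
    rintro x y ⟨⟨γ, hγ⟩, rfl⟩
    refine Quotient.sound ⟨(γ : Bˣ)⁻¹, Units.map (toHat B : B →* Hat B) (γ : Bˣ), hγ, ?_, ?_⟩
    · exact (inv_smul_smul (γ : Bˣ) y.1).symm
    · simp)

end Shimura

/-! ### Double coset correspondences -/

section Hecke
variable {G S : Type*} [Group G] [MulAction G S]

/-- A right coset `Γ' α` maps `x` to the point `Γ' α x` of `Γ' \ S`. -/
def cosetPoint (Γ' : Subgroup G) (x : S) :
    Quotient (QuotientGroup.rightRel Γ') → MulAction.orbitRel.Quotient Γ' S :=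
  Quotient.lift (fun α : G => (Quotient.mk'' (α • x) : MulAction.orbitRel.Quotient Γ' S)) (by
    intro a b hab
    have hab' : b * a⁻¹ ∈ Γ' := QuotientGroup.rightRel_apply.1 hab
    refine Quotient.sound' ⟨⟨b * a⁻¹, hab'⟩⁻¹, ?_⟩
    change (b * a⁻¹)⁻¹ • b • x = a • x
    simp [smul_smul])

/-- The right cosets `Γ' α` contained in the double coset `Γ' g Γ`. -/
def cosetsIn (Γ' : Subgroup G) (g : G) (Γ : Subgroup G) :
    Set (Quotient (QuotientGroup.rightRel Γ')) :=
  (fun α : G => (Quotient.mk'' α : Quotient (QuotientGroup.rightRel Γ'))) ''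
    DoubleCoset.doubleCoset g Γ' Γ

/-- `∑ Γ' α x`, the sum over the right cosets `Γ' α` contained in `Γ' g Γ`. -/
def cosetDiv (Γ' : Subgroup G) (g : G) (Γ : Subgroup G) (x : S) :
    MulAction.orbitRel.Quotient Γ' S →₀ ℤ :=
  ∑ᶠ c ∈ cosetsIn Γ' g Γ, Finsupp.single (cosetPoint Γ' x c) 1

/-- The bijection `Γ' α ↦ Γ' α γ` of the set of right cosets. -/
def cosetMul (Γ' : Subgroup G) (γ : G) :
    Quotient (QuotientGroup.rightRel Γ') → Quotient (QuotientGroup.rightRel Γ') :=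
  Quotient.map' (fun α => α * γ) (by
    intro a b hab
    have hab' : b * a⁻¹ ∈ Γ' := QuotientGroup.rightRel_apply.1 hab
    exact QuotientGroup.rightRel_apply.2 (by simpa [mul_assoc] using hab'))

theorem cosetDiv_smul (Γ' : Subgroup G) (g : G) (Γ : Subgroup G) (γ : Γ) (x : S) :
    cosetDiv Γ' g Γ (γ • x) = cosetDiv Γ' g Γ x := by
  have hinv : ∀ (δ : G) (c : Quotient (QuotientGroup.rightRel Γ')),
      cosetMul Γ' δ⁻¹ (cosetMul Γ' δ c) = c := by
    intro δ c
    induction c using Quotient.inductionOn' with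
    | h α => exact congrArg Quotient.mk'' (mul_inv_cancel_right α δ)
  have hmaps : ∀ δ ∈ Γ, Set.MapsTo (cosetMul Γ' δ) (cosetsIn Γ' g Γ) (cosetsIn Γ' g Γ) := by
    rintro δ hδ _ ⟨α, hα, rfl⟩
    obtain ⟨a, ha, b, hb, rfl⟩ := DoubleCoset.mem_doubleCoset.1 hα
    exact ⟨a * g * b * δ, DoubleCoset.mem_doubleCoset.2
      ⟨a, ha, b * δ, Γ.mul_mem hb hδ, by simp [mul_assoc]⟩, rfl⟩
  refine finsum_mem_eq_of_bijOn (cosetMul Γ' (γ : G)) ⟨hmaps _ γ.2, ?_, ?_⟩ ?_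
  · exact Function.LeftInverse.injective (hinv γ) |>.injOn
  · intro c hc
    refine ⟨cosetMul Γ' (γ : G)⁻¹ c, hmaps _ (Γ.inv_mem γ.2) hc, ?_⟩
    simpa using hinv (γ : G)⁻¹ c
  · intro c _
    induction c using Quotient.inductionOn' with
    | h α =>
      have : cosetPoint Γ' (γ • x) (Quotient.mk'' α) =
          cosetPoint Γ' x (cosetMul Γ' γ (Quotient.mk'' α)) :=
        congrArg Quotient.mk'' (mul_smul α (γ : G) x).symm
      rw [this]

/-- The correspondence `Γ' · g · Γ` from `Γ \ S` to `Γ' \ S`, as a homomorphism of groups of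
divisors: it maps `Γ x` to the sum of the points `Γ' α x`, where `Γ' α` runs through the right
cosets contained in `Γ' g Γ`. -/
def doubleCosetCorr (Γ' : Subgroup G) (g : G) (Γ : Subgroup G) :
    (MulAction.orbitRel.Quotient Γ S →₀ ℤ) →+ (MulAction.orbitRel.Quotient Γ' S →₀ ℤ) :=
  Finsupp.liftAddHom fun P => (zmultiplesHom _) (Quotient.lift (cosetDiv Γ' g Γ) (by
    rintro x y ⟨γ, rfl⟩
    exact cosetDiv_smul Γ' g Γ γ y) P)

end Hecke

section Corr
variable {B : Type*} [Ring B] [Algebra ℚ B]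
  (ψ : ℝ ⊗[ℚ] B ≃ₐ[ℝ] Matrix (Fin 2) (Fin 2) ℝ)

/-- The correspondence `Γ_V · 1 · Γ_U`, from divisors on `Γ_U \ ℋ*` to divisors on
`Γ_V \ ℋ*` and hence, through `[x] ↦ [x, 1]`, to divisors on `X_V(ℂ)`. -/
def curveCorr (V U : Subgroup (Hat B)ˣ) :
    (MulAction.orbitRel.Quotient (gam ψ U) (HStar ψ) →₀ ℤ) →+ (ShimuraCurve ψ V →₀ ℤ) :=
  (Finsupp.mapDomain.addMonoidHom (unif ψ V)).comp (doubleCosetCorr (gam ψ V) 1 (gam ψ U))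

variable {ψ} in
/-- The point of `Γ_U \ ℋ*` given by a point of the upper half plane. -/
def upperPoint (U : Subgroup (Hat B)ˣ) (z : NonReal) (hz : 0 < z.1.im) :
    MulAction.orbitRel.Quotient (gam ψ U) (HStar ψ) :=
  Quotient.mk'' (ofUpper z hz)

/-- For `U ≤ V`, the point of `Γ_V \ ℋ*` given by `z` corresponds to the image in `X_V(ℂ)` of
the point `[z, 1]` of `X_U(ℂ)`. -/
theorem unif_upperPoint {U V : Subgroup (Hat B)ˣ} (h : U ≤ V) (z : NonReal) (hz : 0 < z.1.im) :
    unif ψ V (upperPoint V z hz) = proj ψ h (cls U (ofNonReal z) 1) := rfl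

end Corr

/-! ### Orders in `K` and ring class fields -/

section Field
variable (K : Type*) [Field K]

/-- The order `ℤ + c 𝓞_K` of conductor `c`. -/
def conductorOrder (c : ℕ) : Subring K where
  carrier := {x | ∃ n : ℤ, ∃ a : NumberField.RingOfIntegers K, x = n + c * (a : K)}
  zero_mem' := ⟨0, 0, by simp⟩
  one_mem' := ⟨1, 0, by simp⟩
  add_mem' := by
    rintro _ _ ⟨n, a, rfl⟩ ⟨m, b, rfl⟩
    exact ⟨n + m, a + b, by push_cast; ring⟩
  neg_mem' := by
    rintro _ ⟨n, a, rfl⟩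
    exact ⟨-n, -a, by push_cast; ring⟩
  mul_mem' := by
    rintro _ _ ⟨n, a, rfl⟩ ⟨m, b, rfl⟩
    exact ⟨n * m, n * b + m * a + c * a * b, by simp; ring⟩

/-- The unit group `𝒪_cˣ`, as a subgroup of `Kˣ`. -/
def conductorUnits (c : ℕ) : Subgroup Kˣ := (conductorOrder K c).toSubmonoid.units

/-- The subgroup `Kˣ 𝒪̂_cˣ` of `K̂ˣ`. -/
def ringClassSubgroup (c : ℕ) : Subgroup (Hat K)ˣ :=
  (Units.map (toHat K : K →* Hat K)).range ⊔ (hatSubring (conductorOrder K c)).toSubmonoid.units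

variable [NumberField K]

/-- `L/K` is a finite Galois extension with Artin map `art`, and it is the ring class field of
conductor `c`: the map `art` induces an isomorphism from `K̂ˣ / Kˣ 𝒪̂_cˣ` to `Gal(L/K)`. The last
condition says that `art` is the Artin map: if the idele `a` is integral, congruent to `1`
modulo `c`, and generates the prime ideal `𝔮` (so that `𝔮` does not divide `c`), then `art a` is the
arithmetic Frobenius element at `𝔮`. -/
structure IsRingClassField (c : ℕ) (L : Type*) [Field L] [NumberField L] [Algebra K L]
    (art : (Hat K)ˣ →* (L ≃ₐ[K] L)) : Prop where
  isGalois : IsGalois K L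
  surjective : Function.Surjective art
  ker_eq : art.ker = ringClassSubgroup K c
  frobenius : ∀ (𝔮 : Ideal (NumberField.RingOfIntegers K)), 𝔮.IsPrime → 𝔮 ≠ ⊥ →
    ∀ a : (Hat K)ˣ,
      (a : Hat K) ∈ hatSubring (conductorOrder K 1) →
      (∃ b ∈ hatSubring (conductorOrder K 1), (a : Hat K) = 1 + c * b) →
      (∀ x : NumberField.RingOfIntegers K, x ∈ 𝔮 ↔
        ∃ b ∈ hatSubring (conductorOrder K 1), toHat K (x : K) = a * b) →
    ∀ 𝔔 : Ideal (NumberField.RingOfIntegers L), 𝔔.IsPrime →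
      𝔔.comap (algebraMap (NumberField.RingOfIntegers K) (NumberField.RingOfIntegers L)) = 𝔮 →
    ∀ x : NumberField.RingOfIntegers L, ∃ y ∈ 𝔔,
      art a (x : L) = (x : L) ^ Ideal.absNorm 𝔮 + (y : L)

/-- An intermediate field `F` of `L/K` is the ring class field of conductor `c`: the composition
of the Artin map with the restriction to `F` has kernel `Kˣ 𝒪̂_cˣ`. -/
def IsRingClassSubfield (c : ℕ) {L : Type*} [Field L] [Algebra K L]
    (art : (Hat K)ˣ →* (L ≃ₐ[K] L)) (F : IntermediateField K L) : Prop :=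
  ∀ a : (Hat K)ˣ, (∀ x ∈ F, art a x = x) ↔ a ∈ ringClassSubgroup K c

end Field

end CartanCM

end

/-!
Both sides of the identity are sums over `𝒪̂_fˣ / 𝒪̂_pfˣ` of the points `[z₀, ι̂(a)]` of `X_s+`.

On the Galois side, the Artin map carries `𝒪̂_fˣ` onto `Gal(H_pf / H_f)`, and the elements with
trivial image are those of `𝒪̂_fˣ ∩ Kˣ 𝒪̂_pfˣ = 𝒪_fˣ 𝒪̂_pfˣ`, in which `𝒪̂_pfˣ` has
index `[𝒪_fˣ : 𝒪_pfˣ]`. The points are well defined because `Kˣ` fixes `z₀` and `ι̂(𝒪̂_pfˣ) ⊆ R̂_sˣ`.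

On the side of the correspondence, `[α z₀, 1] = [z₀, α⁻¹]` for `α ∈ Γ_ns+`, so that its divisor is
the sum of the points `[z₀, u]` over the cosets `u R̂_s+ˣ` with `u ∈ Γ_ns+`. Modulo `p`, the group
`𝒪̂_fˣ` maps onto the non-split Cartan subgroup, and `𝒪̂_pfˣ` is the inverse image of the scalars
(`exists_cmRed_eq`, `exists_hatMap_inclusion_eq_iff`). Since `diag(1, -1)` lies in `M_s+`, every
element of `R̂_ns+ˣ` is in the coset of some `ι̂(a)` (`exists_cmUnits_inv_mul_mem`), and two elements
of `𝒪̂_fˣ / 𝒪̂_pfˣ` belong to each coset, because the elements of the non-split Cartan subgroup that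
lie in `M_s+` are the scalars and their multiples by one antidiagonal matrix
(`relIndex_comap_cmUnits_eq_two`). This accounts for the factor `2`. Conversely the coset of each
`ι̂(a)` contains an element of `Γ_ns+` (`exists_gam_inv_mul_mem`): `ι̂(a)` can be changed by an element
of `M_s+ ∩ M_ns+` so that its reduction has determinant `1`, and this reduction then lifts to a unit
of reduced norm `1` of `R`.

The lifting is strong approximation modulo `p` (`sl_two_subset_normOneImage_padicMat`), proved as
follows. By density of `B` in `M₂(ℝ)` there is a commutator `w ∈ R` with `w² = d > 0`, where `d` is
not a square modulo `p`, so Pell's equation gives units `T + U w` of norm `1`, close to `1` at `p`.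
There is also `h ∈ R` whose eigenvalues in `ℤ_p` are a unit and an element of valuation `1`. The
conjugate of `T + U w` by `hᵛ` is integral at `p` and reduces to a non-trivial transvection modulo
`p` exactly if `v` is the valuation of `U`; it is integral at the other primes if `U` is divisible
by a high power of the prime-to-`p` part `m` of the norm of `h`, which is arranged by taking `m`-th
powers of `T + U w`, and these leave `v` unchanged (`exists_pell_of_coprime`). The conjugates by
`hᵛ` and by `h⁻ᵛ` give upper and lower transvections, which generate `SL₂(𝔽_p)`.
-/

open scoped TensorProduct Pointwise

noncomputable section

namespace CartanCM

/-! ### Solutions of Pell's equation with prescribed divisibility -/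

/-- The solution `(T, U)ⁿ` of Pell's equation: if `q` divides `T - 1` and `U`, then its second
coordinate is `n U` up to multiples of `q U`. -/
theorem exists_pell_pow {T U d q : ℤ} (h : T ^ 2 - d * U ^ 2 = 1) (hT : q ∣ T - 1) (hU : q ∣ U)
    (n : ℕ) : ∃ T' U' : ℤ, T' ^ 2 - d * U' ^ 2 = 1 ∧ q ∣ T' - 1 ∧ q * U ∣ U' - n * U := by
  induction n with
  | zero => exact ⟨1, 0, by ring, by simp, by simp⟩
  | succ n ih =>
    obtain ⟨T', U', h1, h2, h3⟩ := ih
    obtain ⟨a, ha⟩ := hT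
    obtain ⟨b, hb⟩ := hU
    obtain ⟨a', ha'⟩ := h2
    obtain ⟨b', hb'⟩ := h3
    refine ⟨T * T' + d * U * U', U * T' + T * U', ?_, ?_, ?_⟩
    · linear_combination (T' ^ 2 - d * U' ^ 2) * h + h1
    · refine ⟨a * T' + a' + d * b * U', ?_⟩
      linear_combination T' * ha + ha' + d * U' * hb
    · refine ⟨a' + T * b' + n * a, ?_⟩
      push_cast
      linear_combination U * ha' + T * hb' + n * U * ha

/-- Pell's equation has solutions `(T, (p m)ᵛ U)` with `T ≡ 1` modulo `p` and `U` prime to `p`, for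
some `v > 0`. Taking `m`-th powers of a solution that is trivial modulo `p m` adds factors `m` to
the second coordinate and does not change its `p`-adic valuation `v`. -/
theorem exists_pell_of_coprime {p : ℕ} (hp : p.Prime) {d : ℤ} (hd : 0 < d) (hd' : ¬IsSquare d)
    {m : ℤ} (hm : ¬(p : ℤ) ∣ m) : ∃ (T U : ℤ) (v : ℕ), 0 < v ∧
      T ^ 2 - d * ((p * m) ^ v * U) ^ 2 = 1 ∧ (p : ℤ) ∣ T - 1 ∧ ¬(p : ℤ) ∣ U := by
  have hpZ : Prime (p : ℤ) := Nat.prime_iff_prime_int.1 hp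
  have hm0 : m ≠ 0 := by rintro rfl; exact hm (dvd_zero _)
  have hq : (p * m : ℤ) ≠ 0 := mul_ne_zero hpZ.ne_zero hm0
  have hdq : ¬IsSquare (d * (p * m) ^ 2) := by
    rintro ⟨s, hs⟩
    obtain ⟨t, rfl⟩ : (p * m : ℤ) ∣ s := by
      rw [← Int.pow_dvd_pow_iff two_ne_zero]
      exact ⟨d, by rw [sq s, ← hs]; ring⟩
    exact hd' ⟨t, mul_right_cancel₀ (pow_ne_zero 2 hq) (by rw [hs]; ring)⟩
  obtain ⟨x, y, hxy, hy⟩ := Pell.exists_of_not_isSquare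
    (mul_pos hd (by positivity : 0 < (p * m : ℤ) ^ 2)) hdq
  have hx : x ≠ 0 := by
    rintro rfl
    have : 0 ≤ d * (p * m) ^ 2 * y ^ 2 := by positivity
    linarith
  -- The square of the solution found has its first coordinate congruent to `1` modulo `p m`.
  have hU0 : 2 * x * y * (p * m) ≠ 0 :=
    mul_ne_zero (mul_ne_zero (mul_ne_zero two_ne_zero hx) hy) hq
  obtain ⟨u, hu, hpu⟩ :=
    (FiniteMultiplicity.of_prime_left hpZ hU0).exists_eq_pow_mul_and_not_dvd
  generalize multiplicity (p : ℤ) (2 * x * y * (p * m)) = v at hu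
  have hv0 : 0 < v := by
    refine Nat.pos_of_ne_zero fun h0 => hpu ?_
    rw [h0, pow_zero, one_mul] at hu
    exact ⟨2 * x * y * m, by rw [← hu]; ring⟩
  have hiter : ∀ s : ℕ, ∃ T U u : ℤ, T ^ 2 - d * U ^ 2 = 1 ∧ (p * m : ℤ) ∣ T - 1 ∧
      (p * m : ℤ) ∣ U ∧ m ^ s ∣ U ∧ U = p ^ v * u ∧ ¬(p : ℤ) ∣ u := by
    intro s
    induction s with
    | zero =>
      refine ⟨1 + 2 * d * ((p * m) * y) ^ 2, 2 * x * y * (p * m), u, ?_, ?_, ?_, ?_, hu, hpu⟩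
      · linear_combination (-4 * d * ((p * m) * y) ^ 2) * hxy
      · exact ⟨2 * d * (p * m) * y ^ 2, by ring⟩
      · exact ⟨2 * x * y, by ring⟩
      · simp
    | succ s ih =>
      obtain ⟨T, U, u, h1, h2, h3, h4, h5, h6⟩ := ih
      obtain ⟨T', U', h1', h2', k, hk⟩ := exists_pell_pow h1 h2 h3 m.natAbs
      have hU' : U' = U * (m.natAbs + p * m * k) := by linear_combination hk
      have hmdvd : m ∣ (m.natAbs : ℤ) := Int.dvd_natAbs.2 dvd_rfl
      refine ⟨T', U', u * (m.natAbs + p * m * k), h1', h2', ?_, ?_, ?_, ?_⟩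
      · exact hU' ▸ h3.mul_right _
      · rw [hU', pow_succ]
        exact mul_dvd_mul h4 (dvd_add hmdvd ⟨p * k, by ring⟩)
      · rw [hU', h5]; ring
      · intro h
        rcases hpZ.dvd_or_dvd h with h | h
        · exact h6 h
        · rw [mul_assoc, Int.dvd_add_left ⟨m * k, rfl⟩, Int.dvd_natAbs] at h
          exact hm h
  obtain ⟨T, U, u, h1, h2, -, h4, h5, h6⟩ := hiter v
  have hcop : IsCoprime (m ^ v) ((p : ℤ) ^ v) :=
    (((Prime.coprime_iff_not_dvd hpZ).2 hm).symm).pow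
  rw [h5] at h4
  obtain ⟨w, rfl⟩ := hcop.dvd_of_dvd_mul_left h4
  refine ⟨T, w, v, hv0, ?_, (dvd_mul_right _ _).trans h2, fun h => h6 (h.mul_left _)⟩
  rw [← h1, h5]
  ring

/-! ### Generation of `SL₂` by transvections -/

/-- A submonoid of `M₂(k)` that contains the transvections contains `SL₂(k)`. -/
theorem mem_of_transvections_mem {k : Type*} [Field k] {S : Submonoid (Matrix (Fin 2) (Fin 2) k)}
    (hu : ∀ x : k, !![1, x; 0, 1] ∈ S) (hl : ∀ x : k, !![1, 0; x, 1] ∈ S)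
    (A : Matrix (Fin 2) (Fin 2) k) (hA : A.det = 1) : A ∈ S := by
  have key : ∀ B : Matrix (Fin 2) (Fin 2) k, B.det = 1 → B 1 0 ≠ 0 → B ∈ S := by
    intro B hB h
    rw [Matrix.det_fin_two] at hB
    have : B = !![1, (B 0 0 - 1) / B 1 0; 0, 1] * !![1, 0; B 1 0, 1] *
        !![1, (B 1 1 - 1) / B 1 0; 0, 1] := by
      rw [Matrix.mul_fin_two, Matrix.mul_fin_two]
      conv_lhs => rw [Matrix.eta_fin_two B]
      congr 5
      · field_simp; ring
      · field_simp; linear_combination -hB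
      · ring
      · field_simp; ring
    rw [this]
    exact S.mul_mem (S.mul_mem (hu _) (hl _)) (hu _)
  by_cases h : A 1 0 = 0
  · have hdet := hA
    rw [Matrix.det_fin_two, h] at hA
    have : A = !![1, 0; -1, 1] * (!![1, 0; 1, 1] * A) := by
      rw [← mul_assoc, Matrix.mul_fin_two]
      simp [← Matrix.one_fin_two]
    rw [this]
    refine S.mul_mem (hl _) (key _ (by rw [Matrix.det_mul, hdet, Matrix.det_fin_two_of]; ring) ?_)
    rintro h0
    simp [Matrix.mul_apply, Fin.sum_univ_two, h] at h0
    simp [h0] at hA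
  · exact key A hA h

/-! ### The norm-one units of an order and their reductions -/

section Splittings
variable {p : ℕ} [Fact p.Prime] {B : Type*} [Ring B] (R : Subring B)
  (φ : ℤ_[p] ⊗[ℤ] R ≃ₐ[ℤ_[p]] Matrix (Fin 2) (Fin 2) ℤ_[p])

/-- Entrywise reduction modulo `p`. -/
def redMat (p : ℕ) [Fact p.Prime] :
    Matrix (Fin 2) (Fin 2) ℤ_[p] →+* Matrix (Fin 2) (Fin 2) (ZMod p) :=
  PadicInt.toZMod.mapMatrix

theorem redMat_apply (m : Matrix (Fin 2) (Fin 2) ℤ_[p]) (i j : Fin 2) :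
    redMat p m i j = (m i j).toZMod := rfl

/-- The map `R → M₂(ℤ_p)` given by the splitting `φ` at `p`. -/
def padicMat : R →+* Matrix (Fin 2) (Fin 2) ℤ_[p] :=
  (φ : ℤ_[p] ⊗[ℤ] R →+* Matrix (Fin 2) (Fin 2) ℤ_[p]).comp
    (Algebra.TensorProduct.includeRight : R →ₐ[ℤ] ℤ_[p] ⊗[ℤ] R).toRingHom

theorem padicMat_apply (r : R) : padicMat R φ r = φ (1 ⊗ₜ[ℤ] r) := rfl

theorem toZMod_intCast_eq_zero_iff (n : ℤ) : ((n : ℤ_[p]).toZMod = 0) ↔ (p : ℤ) ∣ n := by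
  rw [map_intCast, ZMod.intCast_zmod_eq_zero_iff_dvd]

/-- `R` surjects onto `M₂(𝔽_p)`. -/
theorem exists_redMat_padicMat_eq (X : Matrix (Fin 2) (Fin 2) (ZMod p)) :
    ∃ r : R, redMat p (padicMat R φ r) = X := by
  have key : ∀ t : ℤ_[p] ⊗[ℤ] R, ∃ r : R, redMat p (φ t) = redMat p (padicMat R φ r) := by
    intro t
    induction t using TensorProduct.induction_on with
    | zero => exact ⟨0, by simp⟩
    | add x y hx hy =>
      obtain ⟨r, hr⟩ := hx
      obtain ⟨s, hs⟩ := hy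
      exact ⟨r + s, by simp only [map_add, hr, hs]⟩
    | tmul z r =>
      refine ⟨(z.toZMod.val : ℕ) * r, ?_⟩
      have : z ⊗ₜ[ℤ] r = z • ((1 : ℤ_[p]) ⊗ₜ[ℤ] r) := by
        rw [TensorProduct.smul_tmul', smul_eq_mul, mul_one]
      rw [this, map_smul, map_mul, map_mul, map_natCast, map_natCast, padicMat_apply]
      ext i j
      rw [← nsmul_eq_mul]
      simp only [redMat_apply, Matrix.smul_apply, smul_eq_mul, map_mul, nsmul_eq_mul,
        ZMod.natCast_zmod_val]
  obtain ⟨Y, rfl⟩ : ∃ Y, redMat p Y = X :=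
    ⟨X.map fun x => (x.val : ℤ_[p]), by ext i j; simp [redMat_apply]⟩
  obtain ⟨r, hr⟩ := key (φ.symm Y)
  exact ⟨r, by rw [← hr, φ.apply_symm_apply]⟩

variable [Algebra ℚ B] (ψ : ℝ ⊗[ℚ] B ≃ₐ[ℝ] Matrix (Fin 2) (Fin 2) ℝ)

/-- The map `B → M₂(ℝ)` given by the real splitting `ψ`. -/
def realMat : B →ₐ[ℚ] Matrix (Fin 2) (Fin 2) ℝ :=
  ((ψ : ℝ ⊗[ℚ] B →ₐ[ℝ] Matrix (Fin 2) (Fin 2) ℝ).restrictScalars ℚ).comp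
    (Algebra.TensorProduct.includeRight : B →ₐ[ℚ] ℝ ⊗[ℚ] B)

theorem realMat_apply (b : B) : realMat ψ b = ψ (1 ⊗ₜ[ℚ] b) := rfl

theorem realMat_injective : Function.Injective (realMat ψ) :=
  ψ.injective.comp
    (Algebra.TensorProduct.includeRight_injective (algebraMap ℚ ℝ).injective)

/-- `B` is dense in `B ⊗ ℝ = M₂(ℝ)`. -/
theorem denseRange_realMat : DenseRange (realMat ψ) := by
  intro Y
  obtain ⟨t, rfl⟩ := ψ.surjective Y
  let S : AddSubgroup (Matrix (Fin 2) (Fin 2) ℝ) := (realMat ψ : B →+ _).range.topologicalClosure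
  have hS : ∀ x ∈ closure (Set.range (realMat ψ)), x ∈ S := fun x hx => hx
  have hS' : ∀ x ∈ S, x ∈ closure (Set.range (realMat ψ)) := fun x hx => hx
  apply hS'
  induction t using TensorProduct.induction_on with
  | zero => rw [map_zero]; exact S.zero_mem
  | add x y hx hy => rw [map_add]; exact S.add_mem hx hy
  | tmul r b =>
    apply hS
    have h1 : ψ (r ⊗ₜ[ℚ] b) = r • realMat ψ b := by
      rw [realMat_apply, ← map_smul, TensorProduct.smul_tmul', smul_eq_mul, mul_one]
    rw [h1]
    have hcont : Continuous fun s : ℝ => s • realMat ψ b := by fun_prop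
    refine map_mem_closure (f := fun s : ℝ => s • realMat ψ b) hcont (Rat.denseRange_cast r) ?_
    rintro _ ⟨q, rfl⟩
    exact ⟨q • b, by rw [map_smul]; exact (Rat.cast_smul_eq_qsmul ℝ q _).symm⟩

/-- The scalar `(Y Z - Z Y)²`, which is `-det (Y Z - Z Y)` since commutators have trace zero. -/
def commDisc (Y Z : Matrix (Fin 2) (Fin 2) ℝ) : ℝ := -(Y * Z - Z * Y).det

theorem commDisc_smul (t : ℝ) (Y Z : Matrix (Fin 2) (Fin 2) ℝ) :
    commDisc (t • Y) (t • Z) = t ^ 4 * commDisc Y Z := by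
  simp only [commDisc, Matrix.smul_mul, Matrix.mul_smul, smul_smul, ← smul_sub, Matrix.det_smul,
    Fintype.card_fin]
  ring

theorem continuous_commDisc : Continuous fun P : Matrix (Fin 2) (Fin 2) ℝ ×
    Matrix (Fin 2) (Fin 2) ℝ => commDisc P.1 P.2 := by
  unfold commDisc
  fun_prop

variable {R} in
theorem exists_natCast_mul_mem (hRspan : Submodule.span ℚ (R : Set B) = ⊤) (b : B) :
    ∃ n : ℕ, 0 < n ∧ (n : B) * b ∈ R := by
  have hb : b ∈ Submodule.span ℚ (R : Set B) := hRspan ▸ Submodule.mem_top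
  induction hb using Submodule.span_induction with
  | mem x hx => exact ⟨1, one_pos, by simpa using hx⟩
  | zero => exact ⟨1, one_pos, by simp⟩
  | add x y _ _ hx hy =>
    obtain ⟨n, hn, hx⟩ := hx
    obtain ⟨m, hm, hy⟩ := hy
    refine ⟨n * m, Nat.mul_pos hn hm, ?_⟩
    have : ((n * m : ℕ) : B) * (x + y) = (m : B) * ((n : B) * x) + (n : B) * ((m : B) * y) := by
      push_cast
      rw [mul_add, ← mul_assoc, ← mul_assoc, ← Nat.cast_mul, ← Nat.cast_mul, mul_comm m n]
    rw [this]
    exact R.add_mem (R.mul_mem (natCast_mem R m) hx) (R.mul_mem (natCast_mem R n) hy)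
  | smul q x _ hx =>
    obtain ⟨n, hn, hx⟩ := hx
    refine ⟨n * q.den, Nat.mul_pos hn q.den_pos, ?_⟩
    have : ((n * q.den : ℕ) : B) * (q • x) = (q.num : B) * ((n : B) * x) := by
      rw [← nsmul_eq_mul, ← nsmul_eq_mul, ← zsmul_eq_mul, ← Nat.cast_smul_eq_nsmul ℚ,
        ← Nat.cast_smul_eq_nsmul ℚ, ← Int.cast_smul_eq_zsmul ℚ, smul_smul, smul_smul]
      congr 1
      push_cast
      linear_combination (n : ℚ) * q.den_mul_eq_num
    rw [this]
    exact R.mul_mem (intCast_mem R _) hx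

/-- Commutators in `R` whose reduction is a given commutator in `M₂(𝔽_p)` and whose square is
positive at the real place. -/
theorem exists_comm_redMat_eq (hRspan : Submodule.span ℚ (R : Set B) = ⊤)
    (Y Z : Matrix (Fin 2) (Fin 2) (ZMod p)) :
    ∃ y z : R, redMat p (padicMat R φ (y * z - z * y)) = Y * Z - Z * Y ∧
      0 < commDisc (realMat ψ y) (realMat ψ z) := by
  -- Commutators of positive square exist over `ℝ`, so they exist in `B` by density.
  obtain ⟨y₂, z₂, hyz₂⟩ : ∃ y z : B, 0 < commDisc (realMat ψ y) (realMat ψ z) := by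
    have hopen : IsOpen {P : Matrix (Fin 2) (Fin 2) ℝ × Matrix (Fin 2) (Fin 2) ℝ |
        0 < commDisc P.1 P.2} := isOpen_lt continuous_const continuous_commDisc
    obtain ⟨⟨y, z⟩, h⟩ := ((denseRange_realMat ψ).prodMap (denseRange_realMat ψ)).exists_mem_open
      hopen ⟨(!![0, 1; 0, 0], !![0, 0; 1, 0]), by
        simp [commDisc, Matrix.det_fin_two, Matrix.mul_apply, Fin.sum_univ_two]⟩
    exact ⟨y, z, h⟩
  obtain ⟨n, hn, hy⟩ := exists_natCast_mul_mem hRspan y₂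
  obtain ⟨m, hm, hz⟩ := exists_natCast_mul_mem hRspan z₂
  obtain ⟨y₃, z₃, hyz₃⟩ : ∃ y z : R, 0 < commDisc (realMat ψ y) (realMat ψ z) := by
    refine ⟨⟨_, R.mul_mem (natCast_mem R m) hy⟩, ⟨_, R.mul_mem (natCast_mem R n) hz⟩, ?_⟩
    have h1 : ((m : B) * ((n : B) * y₂)) = ((n * m : ℕ) : ℚ) • y₂ := by
      rw [Nat.cast_smul_eq_nsmul, nsmul_eq_mul, ← mul_assoc, ← Nat.cast_mul, mul_comm]
    have h2 : ((n : B) * ((m : B) * z₂)) = ((n * m : ℕ) : ℚ) • z₂ := by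
      rw [Nat.cast_smul_eq_nsmul, nsmul_eq_mul, ← mul_assoc, ← Nat.cast_mul]
    simp only [h1, h2, map_smul]
    rw [← Rat.cast_smul_eq_qsmul ℝ, ← Rat.cast_smul_eq_qsmul ℝ, commDisc_smul]
    have : (0 : ℝ) < (((n * m : ℕ) : ℚ) : ℝ) := by
      rw [Rat.cast_natCast, Nat.cast_pos]; exact Nat.mul_pos hn hm
    positivity
  obtain ⟨y₁, rfl⟩ := exists_redMat_padicMat_eq R φ Y
  obtain ⟨z₁, rfl⟩ := exists_redMat_padicMat_eq R φ Z
  -- Adding large multiples of `p y₃` and `p z₃` preserves the reduction and makes the square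
  -- positive.
  have htend : ∀ a b : R, Filter.Tendsto
      (fun k : ℕ => ((k : ℝ)⁻¹) • realMat ψ a + (p : ℝ) • realMat ψ b) Filter.atTop
      (nhds ((p : ℝ) • realMat ψ b)) := by
    intro a b
    have := ((tendsto_inv_atTop_nhds_zero_nat (𝕜 := ℝ)).smul_const (realMat ψ a)).add_const
      ((p : ℝ) • realMat ψ b)
    simpa using this
  have hpos : 0 < commDisc ((p : ℝ) • realMat ψ y₃) ((p : ℝ) • realMat ψ z₃) := by
    rw [commDisc_smul]
    have : (0 : ℝ) < p := Nat.cast_pos.2 (Fact.out : p.Prime).pos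
    positivity
  have hev := (continuous_commDisc.tendsto _).comp ((htend y₁ y₃).prodMk_nhds (htend z₁ z₃))
  obtain ⟨k, hk, hk0⟩ := ((hev.eventually (lt_mem_nhds hpos)).and
    (Filter.eventually_gt_atTop 0)).exists
  have hk0' : (k : ℝ) ≠ 0 := Nat.cast_ne_zero.2 hk0.ne'
  have hred : ∀ a b : R, redMat p (padicMat R φ (a + k * (p * b))) =
      redMat p (padicMat R φ a) := by
    intro a b
    simp
  have hreal : ∀ a b : R, realMat ψ ((a + k * (p * b) : R) : B) =
      (k : ℝ) • ((k : ℝ)⁻¹ • realMat ψ a + (p : ℝ) • realMat ψ b) := by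
    intro a b
    rw [smul_add, smul_inv_smul₀ hk0']
    push_cast
    simp [Nat.cast_smul_eq_nsmul]
  refine ⟨y₁ + k * (p * y₃), z₁ + k * (p * z₃), ?_, ?_⟩
  · simp only [map_sub, map_mul (padicMat R φ), map_mul (redMat p), hred]
  · rw [hreal, hreal, commDisc_smul]
    exact mul_pos (by positivity) hk

end Splittings

/-! ### Strong approximation modulo `p` -/

section StrongApproximation
variable {p : ℕ} [Fact p.Prime] {B : Type*} [Ring B] [Algebra ℚ B] {R : Subring B}
  (ψ : ℝ ⊗[ℚ] B ≃ₐ[ℝ] Matrix (Fin 2) (Fin 2) ℝ)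

/-- The reduced norm of a unit of `R`. -/
def unitNorm (R : Subring B) : Rˣ →* ℝ :=
  (Matrix.detMonoidHom.comp ((realMat ψ : B →* Matrix (Fin 2) (Fin 2) ℝ).comp
    (R.subtype : R →* B))).comp (Units.coeHom R)

theorem unitNorm_apply (g : Rˣ) : unitNorm ψ R g = (realMat ψ (g : R)).det := rfl

/-- The reductions, under a ring homomorphism `σ : R → M₂(ℤ_p)`, of the units of reduced
norm `1` of `R`. -/
def normOneImage (σ : R →+* Matrix (Fin 2) (Fin 2) ℤ_[p]) :
    Submonoid (Matrix (Fin 2) (Fin 2) (ZMod p)) :=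
  (unitNorm ψ R).ker.toSubmonoid.map
    (((redMat p).comp σ : R →* Matrix (Fin 2) (Fin 2) (ZMod p)).comp (Units.coeHom R))

theorem sq_eq_neg_det {A : Type*} [CommRing A] {W : Matrix (Fin 2) (Fin 2) A}
    (hW : W 0 0 + W 1 1 = 0) : W * W = algebraMap A _ (-W.det) := by
  have h : W 1 1 = -W 0 0 := by linear_combination hW
  rw [Matrix.det_fin_two, Matrix.algebraMap_eq_diagonal]
  ext i j
  fin_cases i <;> fin_cases j <;> simp [Matrix.mul_apply, Fin.sum_univ_two, h] <;> ring

theorem trace_comm_eq_zero {A : Type*} [CommRing A] (Y Z : Matrix (Fin 2) (Fin 2) A) :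
    (Y * Z - Z * Y) 0 0 + (Y * Z - Z * Y) 1 1 = 0 := by
  simp only [Matrix.sub_apply, Matrix.mul_apply, Fin.sum_univ_two]
  ring

theorem det_add_smul {A : Type*} [CommRing A] (a b : A) {W : Matrix (Fin 2) (Fin 2) A}
    (hW : W 0 0 + W 1 1 = 0) : (algebraMap A _ a + b • W).det = a ^ 2 + b ^ 2 * W.det := by
  rw [Matrix.det_fin_two, Matrix.det_fin_two, Matrix.algebraMap_eq_diagonal]
  simp
  linear_combination a * b * hW

/-- The square of a commutator in an order is an integer. -/
theorem exists_comm_sq_eq [Algebra.IsCentral ℚ B]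
    (hRfg : (AddSubgroup.toIntSubmodule R.toAddSubgroup).FG) (y z : R) :
    ∃ d : ℤ, (y * z - z * y) * (y * z - z * y) = (d : R) ∧
      (d : ℝ) = commDisc (realMat ψ y) (realMat ψ z) := by
  set w := y * z - z * y with hw
  have hW : realMat ψ w = realMat ψ y * realMat ψ z - realMat ψ z * realMat ψ y := by
    simp [hw]
  have hsq : realMat ψ ((w : B) * w) = algebraMap ℝ _ (commDisc (realMat ψ y) (realMat ψ z)) := by
    rw [map_mul, hW, sq_eq_neg_det (trace_comm_eq_zero _ _), commDisc]
  have hcent : (w : B) * w ∈ Subalgebra.center ℚ B := by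
    rw [Subalgebra.mem_center_iff]
    intro b
    apply realMat_injective ψ
    rw [map_mul, hsq, map_mul, hsq, Algebra.commutes]
  rw [Algebra.IsCentral.center_eq_bot, Algebra.mem_bot] at hcent
  obtain ⟨q, hq⟩ := hcent
  have hint : IsIntegral ℤ ((w : B) * w) := by
    refine IsIntegral.of_mem_of_fg (subalgebraOfSubring R) hRfg _ (R.mul_mem w.2 w.2)
  have hnt : Nontrivial B := by
    have := (realMat ψ : B →+* Matrix (Fin 2) (Fin 2) ℝ).domain_nontrivial
    exact this
  rw [← hq, isIntegral_algebraMap_iff (algebraMap ℚ B).injective] at hint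
  obtain ⟨d, rfl⟩ := IsIntegrallyClosed.isIntegral_iff.1 hint
  refine ⟨d, Subtype.ext ?_, ?_⟩
  · push_cast
    rw [← hq]
    simp
  · rw [← hq] at hsq
    simp only [eq_intCast, map_intCast] at hsq
    rw [← map_intCast (algebraMap ℝ (Matrix (Fin 2) (Fin 2) ℝ))] at hsq
    exact (algebraMap ℝ (Matrix (Fin 2) (Fin 2) ℝ)).injective hsq

/-- The units of norm one `T + U hᵛ w h'ᵛ` of `R`, where `h h' = M` is an integer and `T + M ᵛ U w`
is a unit of norm one of `ℤ[w]`: this is the conjugate by `hᵛ` of the latter. -/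
theorem exists_unit_conj {w h h' : R} {d M T U : ℤ} {v : ℕ} (hw : w * w = d)
    (hW : realMat ψ w 0 0 + realMat ψ w 1 1 = 0)
    (hh : h * h' = M) (hh' : h' * h = M) (hpell : T ^ 2 - d * (M ^ v * U) ^ 2 = 1) :
    ∃ g : Rˣ, unitNorm ψ R g = 1 ∧ (g : R) = T + U * (h ^ v * w * h' ^ v) := by
  have hcomm : Commute h h' := hh.trans hh'.symm
  have hv : h ^ v * h' ^ v = (M ^ v : ℤ) := by
    rw [← hcomm.mul_pow, hh]; push_cast; rfl
  have hv' : h' ^ v * h ^ v = (M ^ v : ℤ) := by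
    rw [← hcomm.symm.mul_pow, hh']; push_cast; rfl
  generalize M ^ v = N at *
  generalize h ^ v = k at *
  generalize h' ^ v = k' at *
  have hsq : (k * w * k') * (k * w * k') = (d * N ^ 2 : ℤ) := by
    calc (k * w * k') * (k * w * k') = k * w * (k' * k) * w * k' := by noncomm_ring
      _ = N * (k * (w * w) * k') := by
        rw [hv', ← (Int.cast_commute N (k * w)).eq]; noncomm_ring
      _ = (d * N ^ 2 : ℤ) := by
        rw [hw, ← (Int.cast_commute d k).eq, mul_assoc (d : R), hv]
        norm_cast
        congr 1
        ring
  set Y := k * w * k'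
  have hTU : (T : R) * T - U * U * (Y * Y) = 1 := by
    rw [hsq]
    have := congrArg (Int.cast : ℤ → R) hpell
    rw [← Int.cast_one, ← hpell]
    push_cast
    have e1 := (Int.cast_commute d (U : R)).eq
    have e2 := (Int.cast_commute N (U : R)).eq
    norm_cast
    congr 1
    ring
  have hTY : (T : R) * Y = Y * T := (Int.cast_commute T Y).eq
  have hUY : (U : R) * Y = Y * U := (Int.cast_commute U Y).eq
  have hTU' : (T : R) * U = U * T := (Int.cast_commute T (U : R)).eq
  refine ⟨⟨T + U * Y, T - U * Y, ?_, ?_⟩, ?_, rfl⟩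
  · rw [← hTU]
    have : (T + U * Y) * (T - U * Y) = (T : R) * T - T * U * Y + U * (Y * T) - U * (Y * U) * Y := by
      noncomm_ring
    rw [this, ← hTY, ← hUY, hTU']
    noncomm_ring
  · rw [← hTU]
    have : (T - U * Y) * (T + U * Y) = (T : R) * T + T * U * Y - U * (Y * T) - U * (Y * U) * Y := by
      noncomm_ring
    rw [this, ← hTY, ← hUY, hTU']
    noncomm_ring
  · rw [unitNorm_apply]
    have hdet : realMat ψ w * realMat ψ w = algebraMap ℝ _ (-(realMat ψ w).det) :=
      sq_eq_neg_det hW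
    have hd : (realMat ψ w).det = -d := by
      have h1 : realMat ψ w * realMat ψ w = algebraMap ℝ _ (d : ℝ) := by
        rw [← map_mul, ← Subring.coe_mul, hw]
        simp
      have h2 := congrFun (congrFun (h1.symm.trans hdet) 0) 0
      rw [Matrix.algebraMap_eq_diagonal, Matrix.algebraMap_eq_diagonal] at h2
      simp at h2
      linarith
    have hK : realMat ψ k' * realMat ψ k = algebraMap ℝ _ (N : ℝ) := by
      rw [← map_mul, ← Subring.coe_mul, hv']
      simp
    have htr : realMat ψ Y 0 0 + realMat ψ Y 1 1 = 0 := by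
      rw [← Matrix.trace_fin_two] at hW ⊢
      change Matrix.trace (realMat ψ ((k * w * k' : R) : B)) = 0
      push_cast
      rw [map_mul, map_mul, Matrix.trace_mul_cycle, hK, ← Algebra.smul_def, Matrix.trace_smul, hW,
        smul_zero]
    have hdY : (realMat ψ Y).det = -(d * N ^ 2) := by
      change Matrix.det (realMat ψ ((k * w * k' : R) : B)) = _
      have := congrArg Matrix.det hK
      rw [Matrix.det_mul, Matrix.algebraMap_eq_diagonal, Matrix.det_diagonal] at this
      simp only [Pi.algebraMap_apply, Algebra.algebraMap_self, RingHom.id_apply,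
        Finset.prod_const, Finset.card_univ, Fintype.card_fin] at this
      push_cast
      rw [map_mul, map_mul, Matrix.det_mul, Matrix.det_mul, hd]
      linear_combination -(d : ℝ) * this
    have : realMat ψ ((T + U * Y : R) : B) = algebraMap ℝ _ (T : ℝ) + (U : ℝ) • realMat ψ Y := by
      push_cast
      rw [map_add, map_mul, Algebra.smul_def]
      simp
    change (realMat ψ ((T + U * Y : R) : B)).det = 1
    rw [this, det_add_smul _ _ htr, hdY]
    have := congrArg (Int.cast : ℤ → ℝ) hpell
    push_cast at this
    linear_combination this

variable {ψ} in
/-- Conjugates of norm one units of `ℤ[w]` by powers of an element `h` with `σ h` diagonal have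
reductions `1 + N` with `N` antidiagonal. -/
theorem exists_mem_normOneImage {σ : R →+* Matrix (Fin 2) (Fin 2) ℤ_[p]} {w h h' : R} {d m : ℤ}
    (hw : w * w = d) (hd : 0 < d) (hd' : ¬IsSquare d)
    (hW : realMat ψ w 0 0 + realMat ψ w 1 1 = 0)
    (hh : h * h' = (p * m : ℤ)) (hh' : h' * h = (p * m : ℤ)) (hm : ¬(p : ℤ) ∣ m) {α β : ℤ_[p]}
    (hα : σ h = Matrix.diagonal ![α, β]) (hβ : σ h' = Matrix.diagonal ![β, α])
    (hαβ : α.toZMod * β.toZMod = 0) :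
    ∃ (v : ℕ) (u : ZMod p), 0 < v ∧ u ≠ 0 ∧
      !![1, u * α.toZMod ^ v * (σ w 0 1).toZMod; u * β.toZMod ^ v * (σ w 1 0).toZMod, 1] ∈
        normOneImage ψ σ := by
  obtain ⟨T, U, v, hv, hpell, hT, hU⟩ :=
    exists_pell_of_coprime (Fact.out : p.Prime) hd hd' hm
  obtain ⟨g, hg, hg'⟩ := exists_unit_conj ψ hw hW hh hh' hpell
  refine ⟨v * 2, (U : ZMod p), by positivity, ?_, g, hg, ?_⟩
  · rwa [Ne, ZMod.intCast_zmod_eq_zero_iff_dvd]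
  · have hT1 : (T : ZMod p) = 1 := by
      have := (ZMod.intCast_zmod_eq_zero_iff_dvd (T - 1) p).2 hT
      push_cast at this
      linear_combination this
    have hred : σ (g : R) = algebraMap ℤ_[p] _ (T : ℤ_[p]) + (U : ℤ_[p]) •
        (Matrix.diagonal ![α ^ v, β ^ v] * σ w * Matrix.diagonal ![β ^ v, α ^ v]) := by
      rw [hg', map_intCast, Int.cast_smul_eq_zsmul, zsmul_eq_mul]
      simp only [map_add, map_mul, map_intCast, map_pow, hα, hβ, Matrix.diagonal_pow]
      congr 5 <;> ext i <;> fin_cases i <;> rfl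
    change redMat p (σ (g : R)) = _
    rw [hred, Matrix.algebraMap_eq_diagonal]
    ext i j
    fin_cases i <;> fin_cases j <;>
      simp [redMat_apply, Matrix.mul_diagonal, Matrix.diagonal_mul, hT1, pow_mul]
    · rcases mul_eq_zero.1 hαβ with h0 | h0 <;> simp [h0, hv.ne']
    · ring
    · ring
    · rcases mul_eq_zero.1 hαβ with h0 | h0 <;> simp [h0, hv.ne']

theorem upper_transvection_mem {k : ℕ} [Fact k.Prime] {S : Submonoid (Matrix (Fin 2) (Fin 2) (ZMod k))}
    {x : ZMod k} (hx : x ≠ 0) (h : !![1, x; 0, 1] ∈ S) (y : ZMod k) : !![1, y; 0, 1] ∈ S := by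
  have key : ∀ n : ℕ, !![1, x; 0, 1] ^ n = !![1, n * x; 0, 1] := by
    intro n
    induction n with
    | zero => simp [Matrix.one_fin_two]
    | succ n ih =>
      rw [pow_succ, ih, Matrix.mul_fin_two]
      congr 3 <;> push_cast <;> ring_nf
  have := S.pow_mem h (y / x).val
  rwa [key, ZMod.natCast_zmod_val, div_mul_cancel₀ _ hx] at this

theorem lower_transvection_mem {k : ℕ} [Fact k.Prime] {S : Submonoid (Matrix (Fin 2) (Fin 2) (ZMod k))}
    {x : ZMod k} (hx : x ≠ 0) (h : !![1, 0; x, 1] ∈ S) (y : ZMod k) : !![1, 0; y, 1] ∈ S := by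
  have key : ∀ n : ℕ, !![1, 0; x, 1] ^ n = !![1, 0; n * x, 1] := by
    intro n
    induction n with
    | zero => simp [Matrix.one_fin_two]
    | succ n ih =>
      rw [pow_succ, ih, Matrix.mul_fin_two]
      congr 3 <;> push_cast <;> ring_nf
  have := S.pow_mem h (y / x).val
  rwa [key, ZMod.natCast_zmod_val, div_mul_cancel₀ _ hx] at this

/-- If `σ h` is diagonal with one eigenvalue divisible by `p` and the other not, then conjugation by
powers of `h` and of its adjoint `h'` yields upper and lower transvections modulo `p`, hence all of
`SL₂(𝔽_p)`. -/
theorem sl_two_subset_normOneImage {σ : R →+* Matrix (Fin 2) (Fin 2) ℤ_[p]} {w h h' : R}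
    {d m : ℤ} (hw : w * w = d) (hd : 0 < d) (hd' : ¬IsSquare d)
    (hW : realMat ψ w 0 0 + realMat ψ w 1 1 = 0)
    (hh : h * h' = (p * m : ℤ)) (hh' : h' * h = (p * m : ℤ)) (hm : ¬(p : ℤ) ∣ m) {α β : ℤ_[p]}
    (hα : σ h = Matrix.diagonal ![α, β]) (hβ : σ h' = Matrix.diagonal ![β, α])
    (hα0 : α.toZMod ≠ 0) (hβ0 : β.toZMod = 0) (hu : (σ w 0 1).toZMod ≠ 0)
    (hl : (σ w 1 0).toZMod ≠ 0) (A : Matrix (Fin 2) (Fin 2) (ZMod p)) (hA : A.det = 1) :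
    A ∈ normOneImage ψ σ := by
  refine mem_of_transvections_mem ?_ ?_ A hA
  · obtain ⟨v, u, hv, hu0, h1⟩ :=
      exists_mem_normOneImage hw hd hd' hW hh hh' hm hα hβ (by rw [hβ0, mul_zero])
    rw [hβ0, zero_pow hv.ne', mul_zero, zero_mul] at h1
    exact upper_transvection_mem (mul_ne_zero (mul_ne_zero hu0 (pow_ne_zero _ hα0)) hu) h1
  · obtain ⟨v, u, hv, hu0, h1⟩ :=
      exists_mem_normOneImage hw hd hd' hW hh' hh hm hβ hα (by rw [hβ0, zero_mul])
    rw [hβ0, zero_pow hv.ne', mul_zero, zero_mul] at h1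
    exact lower_transvection_mem (mul_ne_zero (mul_ne_zero hu0 (pow_ne_zero _ hα0)) hl) h1

theorem two_ne_zero_zmod (hp2 : p ≠ 2) : (2 : ZMod p) ≠ 0 := by
  intro h3
  have : ((2 : ℕ) : ZMod p) = 0 := by exact_mod_cast h3
  rw [ZMod.natCast_eq_zero_iff] at this
  exact hp2 ((Nat.prime_dvd_prime_iff_eq Fact.out Nat.prime_two).1 this)

theorem norm_lt_one_iff_toZMod (x : ℤ_[p]) : ‖x‖ < 1 ↔ x.toZMod = 0 := by
  rw [← PadicInt.mem_nonunits, ← IsLocalRing.mem_maximalIdeal, ← PadicInt.ker_toZMod,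
    RingHom.mem_ker]

theorem isUnit_iff_toZMod_ne_zero (x : ℤ_[p]) : IsUnit x ↔ x.toZMod ≠ 0 := by
  rw [Ne, ← norm_lt_one_iff_toZMod, PadicInt.isUnit_iff, not_lt]
  exact ⟨fun h => h.ge, fun h => le_antisymm (PadicInt.norm_le_one x) h⟩

theorem exists_sq_eq_of_toZMod_eq_one (hp2 : p ≠ 2) {e : ℤ_[p]} (he : e.toZMod = 1) :
    ∃ r : ℤ_[p], r * r = e ∧ r.toZMod = 1 := by
  have h2 : ‖(2 : ℤ_[p])‖ = 1 := by
    rw [← PadicInt.isUnit_iff, isUnit_iff_toZMod_ne_zero, map_ofNat]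
    exact two_ne_zero_zmod hp2
  obtain ⟨r, hr, hr1, -⟩ := hensels_lemma (p := p) (R := ℤ_[p])
    (F := Polynomial.X ^ 2 - Polynomial.C e) (a := 1) (by
      simp only [map_sub, map_pow, Polynomial.aeval_X, one_pow, Polynomial.aeval_C,
        Polynomial.derivative_X_pow, Polynomial.derivative_C]
      simp [h2, norm_lt_one_iff_toZMod, he])
  refine ⟨r, ?_, ?_⟩
  · simp [sub_eq_zero] at hr
    rw [← sq, hr]
  · simp [one_add_one_eq_two, h2] at hr1
    rwa [norm_lt_one_iff_toZMod, map_sub, map_one, sub_eq_zero] at hr1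

/-- Conjugation of a homomorphism to matrices by an invertible matrix. -/
def conjHom {A : Type*} [Ring A] {k : Type*} [CommRing k] (σ : A →+* Matrix (Fin 2) (Fin 2) k)
    (P : (Matrix (Fin 2) (Fin 2) k)ˣ) : A →+* Matrix (Fin 2) (Fin 2) k where
  toFun x := (↑P⁻¹ : Matrix (Fin 2) (Fin 2) k) * σ x * P
  map_one' := by simp
  map_zero' := by simp
  map_add' x y := by rw [map_add, mul_add, add_mul]
  map_mul' x y := by
    rw [map_mul]
    simp only [mul_assoc, Units.mul_inv_cancel_left]

/-- A matrix with square `r²` and trace zero which reduces to `diag(1, -1)` is diagonalizable. -/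
theorem exists_conj_eq_diagonal (hp2 : p ≠ 2) {W : Matrix (Fin 2) (Fin 2) ℤ_[p]} {r : ℤ_[p]}
    (hW : W 0 0 + W 1 1 = 0) (hdet : r * r = -W.det) (hr : r.toZMod = 1)
    (hred : redMat p W = !![1, 0; 0, -1]) :
    ∃ P : (Matrix (Fin 2) (Fin 2) ℤ_[p])ˣ, W * P = P * Matrix.diagonal ![r, -r] := by
  have h00 := congrFun (congrFun hred 0) 0
  have h01 := congrFun (congrFun hred 0) 1
  have h11 := congrFun (congrFun hred 1) 1
  simp [redMat_apply] at h00 h01 h11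
  have hdetP : IsUnit (!![W 0 0 + r, W 0 1; W 1 0, W 1 1 - r]).det := by
    rw [isUnit_iff_toZMod_ne_zero, Matrix.det_fin_two_of]
    simp only [map_sub, map_add, map_mul, h00, h01, h11, hr]
    rw [show (1 + 1 : ZMod p) * (-1 - 1) - 0 * (W 1 0).toZMod = -(2 * 2) by ring]
    exact neg_ne_zero.2 (mul_ne_zero (two_ne_zero_zmod hp2) (two_ne_zero_zmod hp2))
  refine ⟨((Matrix.isUnit_iff_isUnit_det _).2 hdetP).unit, ?_⟩
  rw [IsUnit.unit_spec]
  have h : W 1 1 = -W 0 0 := by linear_combination hW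
  rw [Matrix.det_fin_two, h] at hdet
  ext i j
  fin_cases i <;> fin_cases j <;> simp [Matrix.mul_apply, Fin.sum_univ_two, h]
  · linear_combination -hdet
  · ring
  · ring
  · linear_combination -hdet

/-- Strong approximation modulo `p`: the units of reduced norm `1` of `R` surject
onto `SL₂(𝔽_p)`. -/
theorem sl_two_subset_normOneImage_padicMat [Algebra.IsCentral ℚ B] (hp2 : p ≠ 2) {ε : ℤ}
    (hε : ¬IsSquare (ε : ZMod p)) (hRfg : (AddSubgroup.toIntSubmodule R.toAddSubgroup).FG)
    (hRspan : Submodule.span ℚ (R : Set B) = ⊤)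
    (φ : ℤ_[p] ⊗[ℤ] R ≃ₐ[ℤ_[p]] Matrix (Fin 2) (Fin 2) ℤ_[p])
    (A : Matrix (Fin 2) (Fin 2) (ZMod p)) (hA : A.det = 1) :
    A ∈ normOneImage ψ (padicMat R φ) := by
  -- `w` is a non-split element modulo `p` with positive square.
  obtain ⟨y, z, hred, hpos⟩ := exists_comm_redMat_eq R φ ψ hRspan
    !![1, 0; 0, 0] !![0, 1; -(ε : ZMod p), 0]
  obtain ⟨d, hd, hd'⟩ := exists_comm_sq_eq ψ hRfg y z
  -- `w'` is split modulo `p`, with eigenvalues `1` and `-1`.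
  obtain ⟨y', z', hred', -⟩ := exists_comm_redMat_eq R φ ψ hRspan
    !![(0 : ZMod p), 1; 0, 0] !![0, 0; 1, 0]
  obtain ⟨e, he, -⟩ := exists_comm_sq_eq ψ hRfg y' z'
  have hW : realMat ψ (y * z - z * y : R) 0 0 + realMat ψ (y * z - z * y : R) 1 1 = 0 := by
    push_cast
    rw [map_sub, map_mul, map_mul]
    exact trace_comm_eq_zero _ _
  have hV : padicMat R φ (y' * z' - z' * y') 0 0 + padicMat R φ (y' * z' - z' * y') 1 1 = 0 := by
    rw [map_sub, map_mul, map_mul]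
    exact trace_comm_eq_zero _ _
  generalize y * z - z * y = w at *
  generalize y' * z' - z' * y' = w' at *
  rw [← hd'] at hpos
  simp at hred hred'
  have hdε : (d : ZMod p) = ε := by
    have := congrArg (redMat p) (congrArg (padicMat R φ) hd)
    rw [map_mul, map_mul, hred, map_intCast, map_intCast,
      ← map_intCast (algebraMap (ZMod p) (Matrix (Fin 2) (Fin 2) (ZMod p))),
      Matrix.algebraMap_eq_diagonal] at this
    simpa using (congrFun (congrFun this 0) 0).symm
  have hdsq : ¬IsSquare d := by
    rintro ⟨s, rfl⟩
    exact hε ⟨s, by rw [← hdε]; push_cast; rfl⟩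
  have hesq := congrArg (padicMat R φ) he
  rw [map_mul, sq_eq_neg_det hV, map_intCast, 
    ← map_intCast (algebraMap ℤ_[p] (Matrix (Fin 2) (Fin 2) ℤ_[p]))] at hesq
  replace hesq : -(padicMat R φ w').det = e :=
    FaithfulSMul.algebraMap_injective ℤ_[p] (Matrix (Fin 2) (Fin 2) ℤ_[p]) hesq
  have he1 : (e : ℤ_[p]).toZMod = 1 := by
    rw [← hesq, map_neg, RingHom.map_det]
    change -(redMat p (padicMat R φ w')).det = 1
    rw [hred']
    simp
  obtain ⟨r, hr, hr1⟩ := exists_sq_eq_of_toZMod_eq_one hp2 he1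
  obtain ⟨P, hP⟩ := exists_conj_eq_diagonal hp2 hV (hr.trans hesq.symm) hr1 hred'
  -- `n ≡ r + p` modulo `p²`, so that `n - r` has valuation `1`, and so has `n² - e`.
  obtain ⟨k, hk⟩ := Ideal.mem_span_singleton.1 (PadicInt.appr_spec 2 r)
  obtain ⟨n, hn⟩ : ∃ n : ℤ, (n : ℤ_[p]) = r + p * (1 - p * k) :=
    ⟨r.appr 2 + p, by push_cast; linear_combination -hk⟩
  have hn1 : (n : ZMod p) = 1 := by
    have := congrArg PadicInt.toZMod hn
    simpa [hr1] using this
  have h2 := two_ne_zero_zmod hp2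
  obtain ⟨m, hm⟩ : (p : ℤ) ∣ n ^ 2 - e := by
    rw [← ZMod.intCast_zmod_eq_zero_iff_dvd]
    rw [map_intCast] at he1
    push_cast
    rw [hn1, he1]
    ring
  have hpm : ¬(p : ℤ) ∣ m := by
    rw [← toZMod_intCast_eq_zero_iff (p := p)]
    have hp0 : (p : ℤ_[p]) ≠ 0 := Nat.cast_ne_zero.2 (Fact.out : p.Prime).ne_zero
    have : (m : ℤ_[p]) = (1 - p * k) * (n + r) := by
      apply mul_left_cancel₀ hp0
      have := congrArg (Int.cast : ℤ → ℤ_[p]) hm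
      push_cast at this
      linear_combination -this + hr + (n + r) * hn
    rw [this]
    simp [hn1, hr1, one_add_one_eq_two, h2]
  have hconj : ∀ x, padicMat R φ x = (P : Matrix (Fin 2) (Fin 2) ℤ_[p]) *
      conjHom (padicMat R φ) P x * (↑P⁻¹ : Matrix (Fin 2) (Fin 2) ℤ_[p]) := by
    intro x
    simp [conjHom, mul_assoc]
  have hw' : conjHom (padicMat R φ) P w' = Matrix.diagonal ![r, -r] := by
    simp [conjHom, mul_assoc, hP]
  have hdiag : ∀ x y : ℤ_[p], (n : Matrix (Fin 2) (Fin 2) ℤ_[p]) + Matrix.diagonal ![x, y] =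
      Matrix.diagonal ![n + x, n + y] := by
    intro x y
    rw [← map_intCast (algebraMap ℤ_[p] (Matrix (Fin 2) (Fin 2) ℤ_[p])),
      Matrix.algebraMap_eq_diagonal, Matrix.diagonal_add]
    congr 1
    ext i
    fin_cases i <;> simp
  have hM : (n : R) * n - w' * w' = (p * m : ℤ) := by
    rw [he, ← hm]
    push_cast
    rw [sq]
  have hnw : (n : R) * w' = w' * n := (Int.cast_commute n w').eq
  -- `w` has no eigenvector modulo `p`, since `w²` is not a square modulo `p`. So its off-diagonal
  -- entries do not vanish modulo `p` in the eigenbasis of `w'`.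
  have hX : ∀ x y : ZMod p, x * y = 0 → ∀ z : ZMod p, z * z + x * y ≠ ε := by
    intro x y hxy z hz
    exact hε ⟨z, by rw [← hz, hxy, add_zero]⟩
  have hXw : (conjHom (padicMat R φ) P w 0 0).toZMod * (conjHom (padicMat R φ) P w 0 0).toZMod +
      (conjHom (padicMat R φ) P w 0 1).toZMod * (conjHom (padicMat R φ) P w 1 0).toZMod = ε := by
    have := congrArg (redMat p) (congrArg (conjHom (padicMat R φ) P) hd)
    rw [map_mul, map_mul, map_intCast, map_intCast,
      ← map_intCast (algebraMap (ZMod p) (Matrix (Fin 2) (Fin 2) (ZMod p))),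
      Matrix.algebraMap_eq_diagonal] at this
    have := congrFun (congrFun this 0) 0
    rw [Matrix.mul_apply, Fin.sum_univ_two] at this
    simpa [redMat_apply, hdε] using this
  have hnz := sl_two_subset_normOneImage (σ := conjHom (padicMat R φ) P) (w := w) (d := d) (m := m)
    (h := n + w') (h' := n - w') (α := n + r) (β := n - r) ψ hd (by exact_mod_cast hpos) hdsq hW
    (by rw [← hM, mul_sub, add_mul, add_mul, hnw]; abel)
    (by rw [← hM, mul_add, sub_mul, sub_mul, hnw]; abel) hpm
    (by rw [map_add, map_intCast, hw', hdiag, sub_eq_add_neg])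
    (by
      have : -Matrix.diagonal ![r, -r] = Matrix.diagonal ![-r, r] := by
        ext i j
        fin_cases i <;> fin_cases j <;> simp
      rw [map_sub, map_intCast, hw', sub_eq_add_neg, this, hdiag, sub_eq_add_neg])
    (by simp [hn1, hr1, one_add_one_eq_two, h2]) (by simp [hn1, hr1])
    (fun h0 => hX _ _ (by rw [h0, zero_mul]) _ hXw) (fun h0 => hX _ _ (by rw [h0, mul_zero]) _ hXw)
  have hPP : redMat p (↑P⁻¹ : Matrix (Fin 2) (Fin 2) ℤ_[p]) * redMat p P = 1 := by
    rw [← map_mul, Units.inv_mul, map_one]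
  have hPP' : redMat p (P : Matrix (Fin 2) (Fin 2) ℤ_[p]) *
      redMat p (↑P⁻¹ : Matrix (Fin 2) (Fin 2) ℤ_[p]) = 1 := by
    rw [← map_mul, Units.mul_inv, map_one]
  obtain ⟨g, hg, hg'⟩ := hnz
    (redMat p (↑P⁻¹ : Matrix (Fin 2) (Fin 2) ℤ_[p]) * A * redMat p P) (by
      rw [Matrix.det_mul, Matrix.det_mul, hA, mul_one, ← Matrix.det_mul, hPP, Matrix.det_one])
  refine ⟨g, hg, ?_⟩
  change redMat p (padicMat R φ (g : R)) = A
  change redMat p (conjHom (padicMat R φ) P (g : R)) = _ at hg'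
  rw [hconj, map_mul, map_mul, hg', mul_assoc, mul_assoc, mul_assoc, hPP', mul_one, ← mul_assoc,
    hPP', one_mul]

end StrongApproximation

/-! ### Profinite completions of torsion-free rings -/

section Completion
variable {A A' A'' : Type*} [Ring A] [Ring A'] [Ring A'']

theorem toHat_apply (a : A) : toHat A a = 1 ⊗ₜ[ℤ] a := rfl

theorem hatMap_tmul (g : A →+* A') (z : Zhat) (a : A) :
    hatMap g (z ⊗ₜ[ℤ] a) = z ⊗ₜ[ℤ] g a := rfl

theorem hatMap_toHat (g : A →+* A') (a : A) : hatMap g (toHat A a) = toHat A' (g a) := rfl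

theorem hatMap_hatMap (g : A →+* A') (g' : A' →+* A'') (x : Hat A) :
    hatMap g' (hatMap g x) = hatMap (g'.comp g) x := by
  induction x using TensorProduct.induction_on with
  | zero => simp
  | tmul z a => rfl
  | add x y hx hy => simp only [map_add, hx, hy]

theorem hatMap_injective {g : A →+* A'} (hg : Function.Injective g) :
    Function.Injective (hatMap g) := by
  exact Module.Flat.lTensor_preserves_injective_linearMap (M := Zhat)
    (g.toIntAlgHom.toLinearMap) hg

/-- `r ∈ q A` if the image of `r` in `𝔽_q ⊗ A` vanishes. -/
theorem exists_eq_smul_of_tmul_eq_zero (q : ℕ) {r : A} (h : (1 : ZMod q) ⊗ₜ[ℤ] r = 0) :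
    ∃ s : A, r = q • s := by
  have h1 := congrArg (LinearMap.rTensor A
    (Int.quotientSpanNatEquivZMod q).symm.toAddEquiv.toIntLinearEquiv.toLinearMap) h
  rw [map_zero, LinearMap.rTensor_tmul] at h1
  have h2 := congrArg (TensorProduct.quotTensorEquivQuotSMul A (Ideal.span {(q : ℤ)})) h1
  have h3 : (Int.quotientSpanNatEquivZMod q).symm.toAddEquiv.toIntLinearEquiv.toLinearMap 1 =
      Ideal.Quotient.mk (Ideal.span {(q : ℤ)}) 1 := map_one (Int.quotientSpanNatEquivZMod q).symm
  rw [map_zero, h3, TensorProduct.quotTensorEquivQuotSMul_mk_tmul, one_smul,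
    Submodule.Quotient.mk_eq_zero, Submodule.ideal_span_singleton_smul,
    Submodule.mem_smul_pointwise_iff_exists] at h2
  obtain ⟨s, -, hs⟩ := h2
  exact ⟨s, by rw [← hs, natCast_zsmul]⟩

/-- `A ∩ Ŝ = S` for a subring `S` of `A` such that `A / S` is torsion. -/
theorem mem_of_toHat_mem_hatSubring [IsAddTorsionFree A] {S : Subring A}
    (hS : ∀ a : A, ∃ n : ℕ, 0 < n ∧ (n : A) * a ∈ S) {a : A} (ha : toHat A a ∈ hatSubring S) :
    a ∈ S := by
  obtain ⟨n, hn, hna⟩ := hS a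
  induction n using Nat.recOnMul generalizing a with
  | zero => exact absurd hn (lt_irrefl _)
  | one => simpa using hna
  | prime q hq =>
    obtain ⟨y, hy⟩ := ha
    have hy' : (q : Hat S) * y = toHat S ⟨_, hna⟩ := by
      apply hatMap_injective (g := S.subtype) Subtype.val_injective
      rw [map_mul, hy, hatMap_toHat, map_natCast]
      simp
    have : Fact q.Prime := ⟨hq⟩
    let π : Hat S →+* ZMod q ⊗[ℤ] S := (Algebra.TensorProduct.map
      ((PadicInt.toZMod (p := q)).toIntAlgHom) (AlgHom.id ℤ S)).toRingHom.comp (toLocal q S)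
    have h0 : (1 : ZMod q) ⊗ₜ[ℤ] (⟨_, hna⟩ : S) = 0 := by
      have h1 : π (toHat S ⟨_, hna⟩) = (1 : ZMod q) ⊗ₜ[ℤ] (⟨_, hna⟩ : S) := by
        have h2 : ∀ (z : Zhat) (s : S), π (z ⊗ₜ[ℤ] s) =
            (z ⟨q, hq⟩).toZMod ⊗ₜ[ℤ] s := fun _ _ => rfl
        rw [toHat_apply, h2]
        exact congrArg (· ⊗ₜ[ℤ] (⟨_, hna⟩ : S)) (map_one PadicInt.toZMod)
      rw [← h1, ← hy', map_mul, map_natCast]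
      have : (q : ZMod q ⊗[ℤ] S) = 0 := by
        rw [← map_natCast (algebraMap (ZMod q) (ZMod q ⊗[ℤ] S)), CharP.cast_eq_zero, map_zero]
      rw [this, zero_mul]
    obtain ⟨s, hs⟩ := exists_eq_smul_of_tmul_eq_zero q h0
    have : (q : ℕ) • a = q • (s : A) := by
      rw [nsmul_eq_mul]
      exact congrArg Subtype.val hs
    rw [nsmul_right_injective hq.ne_zero this]
    exact s.2
  | mul m k hm hk =>
    have hk0 : 0 < k := Nat.pos_of_mul_pos_left hn
    have hm0 : 0 < m := Nat.pos_of_mul_pos_right hn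
    refine hk ha hk0 (hm ?_ hm0 ?_)
    · rw [map_mul, map_natCast]
      exact (hatSubring S).mul_mem (natCast_mem _ _) ha
    · rwa [← mul_assoc, ← Nat.cast_mul]

end Completion

/-! ### Units of `R̂` and their `p`-components -/

section Levels
variable {p : ℕ} [hp : Fact p.Prime] {B : Type*} [Ring B] (R : Subring B)
  (φ : ℤ_[p] ⊗[ℤ] R ≃ₐ[ℤ_[p]] Matrix (Fin 2) (Fin 2) ℤ_[p])

/-- The map `R̂ → M₂(ℤ_p)`, `x ↦ x_p`. -/
def hatMat : Hat R →+* Matrix (Fin 2) (Fin 2) ℤ_[p] :=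
  (φ : ℤ_[p] ⊗[ℤ] R →+* Matrix (Fin 2) (Fin 2) ℤ_[p]).comp (toLocal p R)

theorem hatMat_tmul (z : Zhat) (r : R) :
    hatMat R φ (z ⊗ₜ[ℤ] r) = z ⟨p, hp.out⟩ • padicMat R φ r := by
  rw [padicMat_apply, ← map_smul, TensorProduct.smul_tmul', smul_eq_mul, mul_one]
  rfl

/-- The inclusion `R̂ˣ → B̂ˣ`. -/
def hatIncl (R : Subring B) : (Hat R)ˣ →* (Hat B)ˣ :=
  Units.map (hatMap R.subtype : Hat R →* Hat B)

variable {R φ} {M : Submonoid (Matrix (Fin 2) (Fin 2) ℤ_[p])}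

/-- If `M` is defined by congruences modulo `p`, then the units `y` of `R̂` with `y_p ∈ M` also
satisfy `y_p⁻¹ ∈ M`, because modulo `p` the inverse is a power of `y`. -/
theorem hatIncl_mem_hatLevelUnits_iff
    (hM : ∀ m m', redMat p m = redMat p m' → m ∈ M → m' ∈ M) (y : (Hat R)ˣ) :
    hatIncl R y ∈ hatLevelUnits R φ M ↔ hatMat R φ y ∈ M := by
  constructor
  · intro h
    obtain ⟨x, hx, hxy⟩ := (Submonoid.mem_units_iff _ _).1 h |>.1
    rwa [← hatMap_injective (g := R.subtype) Subtype.val_injective hxy]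
  · intro h
    refine (Submonoid.mem_units_iff _ _).2 ⟨⟨y, h, rfl⟩, ⟨(y⁻¹ : (Hat R)ˣ), ?_, rfl⟩⟩
    let g : (Matrix (Fin 2) (Fin 2) (ZMod p))ˣ :=
      Units.map ((redMat p).comp (hatMat R φ) : Hat R →* Matrix (Fin 2) (Fin 2) (ZMod p)) y
    have hg : g⁻¹ = g ^ (orderOf g - 1) := by
      rw [inv_eq_iff_mul_eq_one, ← pow_succ', Nat.sub_add_cancel (orderOf_pos g),
        pow_orderOf_eq_one]
    refine hM (hatMat R φ y ^ (orderOf g - 1)) _ ?_ (M.pow_mem h _)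
    have := congrArg Units.val hg
    rw [Units.val_pow_eq_pow_val] at this
    rw [map_pow]
    exact this.symm

theorem exists_hatIncl_eq {u : (Hat B)ˣ} (hu : u ∈ hatLevelUnits R φ M) :
    ∃ y : (Hat R)ˣ, hatIncl R y = u := by
  obtain ⟨⟨x, -, hx⟩, ⟨x', -, hx'⟩⟩ := (Submonoid.mem_units_iff _ _).1 hu
  have hinj := hatMap_injective (g := R.subtype) Subtype.val_injective
  change hatMap R.subtype x = u at hx
  change hatMap R.subtype x' = ((u⁻¹ : (Hat B)ˣ) : Hat B) at hx'
  refine ⟨⟨x, x', hinj ?_, hinj ?_⟩, Units.ext hx⟩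
  · rw [map_mul, hx, hx', Units.mul_inv, map_one]
  · rw [map_mul, hx, hx', Units.inv_mul, map_one]

end Levels

/-! ### Reduction of the units of a quadratic order -/

section QuadraticOrder
variable {K : Type*} [Field K] {S S' : Subring K}

/-- The units of `Ŝ`, as a subgroup of `K̂ˣ`, are the image of `Ŝˣ`. -/
theorem mem_units_hatSubring_iff (u : (Hat K)ˣ) :
    u ∈ (hatSubring S).toSubmonoid.units ↔ ∃ a : (Hat S)ˣ, hatIncl S a = u := by
  constructor
  · intro hu
    obtain ⟨⟨x, hx⟩, ⟨x', hx'⟩⟩ := (Submonoid.mem_units_iff _ _).1 hu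
    have hinj := hatMap_injective (g := S.subtype) Subtype.val_injective
    change hatMap S.subtype x' = ((u⁻¹ : (Hat K)ˣ) : Hat K) at hx'
    change hatMap S.subtype x = u at hx
    refine ⟨⟨x, x', hinj ?_, hinj ?_⟩, Units.ext hx⟩
    · rw [map_mul, hx, hx', Units.mul_inv, map_one]
    · rw [map_mul, hx, hx', Units.inv_mul, map_one]
  · rintro ⟨a, rfl⟩
    exact (Submonoid.mem_units_iff _ _).2 ⟨⟨a, rfl⟩, ⟨(a⁻¹ : (Hat S)ˣ), rfl⟩⟩

theorem exists_eq_tmul_add_tmul {ω : S} (hω : ∀ x : S, ∃ m n : ℤ, x = m + n * ω) (a : Hat S) :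
    ∃ α β : Zhat, a = α ⊗ₜ[ℤ] 1 + β ⊗ₜ[ℤ] ω := by
  induction a using TensorProduct.induction_on with
  | zero => exact ⟨0, 0, by simp⟩
  | tmul z x =>
    obtain ⟨m, n, rfl⟩ := hω x
    refine ⟨m • z, n • z, ?_⟩
    rw [TensorProduct.tmul_add, ← zsmul_eq_mul, TensorProduct.tmul_smul, TensorProduct.smul_tmul',
      ← zsmul_one m, TensorProduct.tmul_smul, TensorProduct.smul_tmul']
  | add x y hx hy =>
    obtain ⟨α, β, rfl⟩ := hx
    obtain ⟨α', β', rfl⟩ := hy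
    exact ⟨α + α', β + β', by rw [TensorProduct.add_tmul, TensorProduct.add_tmul]; abel⟩

variable {p : ℕ} [hp : Fact p.Prime] {ε : ℤ} {B : Type*} [Ring B] {R : Subring B}
  (φ : ℤ_[p] ⊗[ℤ] R ≃ₐ[ℤ_[p]] Matrix (Fin 2) (Fin 2) ℤ_[p])
  (θ : S →+* R)

/-- The map `Ŝ → M₂(𝔽_p)` obtained from `θ : S → R` and reduction modulo `p`. -/
def cmRed : Hat S →+* Matrix (Fin 2) (Fin 2) (ZMod p) :=
  ((redMat p).comp (hatMat R φ)).comp (hatMap θ)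

theorem cmRed_tmul (z : Zhat) (x : S) : cmRed φ θ (z ⊗ₜ[ℤ] x) =
    PadicInt.toZMod (z ⟨p, hp.out⟩ : ℤ_[p]) • redMat p (padicMat R φ (θ x)) := by
  change redMat p (hatMat R φ (z ⊗ₜ[ℤ] θ x)) = _
  rw [hatMat_tmul]
  ext i j
  simp [redMat_apply]

theorem cmRed_eq {ω : S} (α β : Zhat) : cmRed φ θ (α ⊗ₜ[ℤ] 1 + β ⊗ₜ[ℤ] ω) =
    PadicInt.toZMod (α ⟨p, hp.out⟩ : ℤ_[p]) • (1 : Matrix (Fin 2) (Fin 2) (ZMod p)) +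
      PadicInt.toZMod (β ⟨p, hp.out⟩ : ℤ_[p]) • redMat p (padicMat R φ (θ ω)) := by
  rw [map_add, cmRed_tmul, cmRed_tmul, map_one, map_one, map_one]

variable {φ θ}

theorem cmRed_mem_ns (h1 : ∀ x, padicMat R φ (θ x) ∈ Mns p ε) (a : Hat S) :
    cmRed φ θ a 0 0 = cmRed φ θ a 1 1 ∧ cmRed φ θ a 0 1 * (ε : ZMod p) = cmRed φ θ a 1 0 := by
  induction a using TensorProduct.induction_on with
  | zero => simp
  | tmul z x =>
    obtain ⟨h, h'⟩ := h1 x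
    rw [cmRed_tmul]
    simp only [Matrix.smul_apply, redMat_apply, h, smul_eq_mul, true_and, ← h', mul_assoc]
  | add x y hx hy =>
    simp only [map_add, Matrix.add_apply, hx.1, hy.1, ← hx.2, ← hy.2, add_mul, and_self]

theorem cmRed_apply_ne_zero (h1 : ∀ x, padicMat R φ (θ x) ∈ Mns p ε)
    (h2 : ∀ x : S, padicMat R φ (θ x) ∈ Ms p ↔ (x : K) ∈ S') {ω : S} (hωS : (ω : K) ∉ S') :
    redMat p (padicMat R φ (θ ω)) 0 1 ≠ 0 := by
  intro h
  refine hωS ((h2 ω).1 ⟨h, ?_⟩)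
  rw [← (h1 ω).2]
  rw [redMat_apply] at h
  rw [h, zero_mul]

/-- An element of `Ŝ` lies in `Ŝ'` if its reduction modulo `p` is scalar. -/
theorem exists_hatMap_inclusion_eq_iff (hSS : S' ≤ S) (h1 : ∀ x, padicMat R φ (θ x) ∈ Mns p ε)
    (h2 : ∀ x : S, padicMat R φ (θ x) ∈ Ms p ↔ (x : K) ∈ S') {ω : S} (hωS : (ω : K) ∉ S')
    (hω : ∀ x : S, ∃ m n : ℤ, x = m + n * ω) (a : Hat S) :
    (∃ y : Hat S', hatMap (Subring.inclusion hSS) y = a) ↔ cmRed φ θ a 0 1 = 0 := by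
  constructor
  · rintro ⟨y, rfl⟩
    induction y using TensorProduct.induction_on with
    | zero => simp
    | tmul z x =>
      have := ((h2 (Subring.inclusion hSS x)).2 x.2).1
      rw [hatMap_tmul, cmRed_tmul, Matrix.smul_apply, redMat_apply, this, smul_zero]
    | add x y hx hy => rw [map_add, map_add, Matrix.add_apply, hx, hy, add_zero]
  · intro h
    obtain ⟨α, β, rfl⟩ := exists_eq_tmul_add_tmul hω a
    rw [cmRed_eq] at h
    have hβ : PadicInt.toZMod (β ⟨p, hp.out⟩ : ℤ_[p]) = 0 := by
      simpa [cmRed_apply_ne_zero h1 h2 hωS] using h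
    have hdvd : ∀ q : Nat.Primes, ∃ c : ℤ_[q], β q = p * c := by
      intro q
      by_cases hq : q = ⟨p, hp.out⟩
      · subst hq
        rw [← RingHom.mem_ker, PadicInt.ker_toZMod, PadicInt.maximalIdeal_eq_span_p,
          Ideal.mem_span_singleton] at hβ
        exact hβ
      · have hu : IsUnit ((p : ℕ) : ℤ_[q]) := by
          rw [PadicInt.isUnit_iff, PadicInt.norm_natCast_eq_one_iff]
          exact (Nat.coprime_primes q.2 hp.out).2 fun h => hq (Subtype.ext h)
        exact hu.dvd
    choose γ hγ using hdvd
    have hβγ : β = p • γ := by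
      ext q
      rw [hγ q, Pi.smul_apply, nsmul_eq_mul]
    have hpω : (((p • ω : S)) : K) ∈ S' := by
      rw [← h2, map_nsmul, map_nsmul]
      constructor <;> simp
    refine ⟨α ⊗ₜ[ℤ] 1 + γ ⊗ₜ[ℤ] ⟨_, hpω⟩, ?_⟩
    rw [map_add, hatMap_tmul, hatMap_tmul, map_one, hβγ]
    congr 1
    exact (TensorProduct.smul_tmul (R := ℤ) p γ ω).symm

/-- The reduction `Ŝˣ → (𝔽_p + 𝔽_p ω)ˣ` is surjective. -/
theorem exists_cmRed_eq (hε : ¬IsSquare (ε : ZMod p)) (h1 : ∀ x, padicMat R φ (θ x) ∈ Mns p ε)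
    (h2 : ∀ x : S, padicMat R φ (θ x) ∈ Ms p ↔ (x : K) ∈ S') {ω : S} (hωS : (ω : K) ∉ S')
    (hω : ∀ x : S, ∃ m n : ℤ, x = m + n * ω) {b c : ZMod p} (hbc : ¬(b = 0 ∧ c = 0)) :
    ∃ a : (Hat S)ˣ, cmRed φ θ a = !![b, c; c * ε, b] := by
  have ht := cmRed_apply_ne_zero h1 h2 hωS
  obtain ⟨hs, hs'⟩ := h1 ω
  simp only [← redMat_apply] at hs hs'
  have hΩ : redMat p (padicMat R φ (θ ω)) = !![redMat p (padicMat R φ (θ ω)) 0 0,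
      redMat p (padicMat R φ (θ ω)) 0 1; redMat p (padicMat R φ (θ ω)) 0 1 * ε,
      redMat p (padicMat R φ (θ ω)) 0 0] := by
    ext i j
    fin_cases i <;> fin_cases j <;> simp [hs, hs']
  generalize redMat p (padicMat R φ (θ ω)) 0 0 = s at *
  generalize redMat p (padicMat R φ (θ ω)) 0 1 = t at *
  obtain ⟨n, hn⟩ := ZMod.intCast_surjective (c / t)
  obtain ⟨m, hm⟩ := ZMod.intCast_surjective (b - (n : ZMod p) * s)
  have hc : c = (n : ZMod p) * t := by rw [hn, div_mul_cancel₀ _ ht]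
  have hb : b = (m : ZMod p) + (n : ZMod p) * s := by rw [hm]; ring
  obtain ⟨m', n', hωω⟩ := hω (ω * ω)
  -- `x'` is the conjugate of `x`, and `ν` is its norm.
  set x : S := m + n * ω with hx
  set x' : S := (m + n * n' : ℤ) - n * ω with hx'
  set ν : ℤ := m ^ 2 + m * n * n' - n ^ 2 * m' with hν
  have hxx' : x * x' = ν := by
    rw [hx, hx', hν]
    push_cast
    linear_combination -(n : S) ^ 2 * hωω
  have hredx : ∀ k l : ℤ, redMat p (padicMat R φ (θ (k + l * ω))) =
      !![(k : ZMod p) + l * s, l * t; l * t * ε, k + l * s] := by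
    intro k l
    simp only [map_add, map_mul, map_intCast, hΩ]
    rw [← map_intCast (algebraMap (ZMod p) (Matrix (Fin 2) (Fin 2) (ZMod p))),
      ← map_intCast (algebraMap (ZMod p) (Matrix (Fin 2) (Fin 2) (ZMod p))), ← Algebra.smul_def,
      Matrix.algebraMap_eq_diagonal]
    ext i j
    fin_cases i <;> fin_cases j <;> simp [mul_assoc]
  have hX : redMat p (padicMat R φ (θ x)) = !![b, c; c * ε, b] := by rw [hx, hredx, hb, hc]
  have hdet : IsUnit !![b, c; c * (ε : ZMod p), b] := by
    rw [Matrix.isUnit_iff_isUnit_det, Matrix.det_fin_two_of, isUnit_iff_ne_zero]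
    intro h0
    by_cases hc0 : c = 0
    · exact hbc ⟨by simpa [hc0] using h0, hc0⟩
    · exact hε ⟨b / c, by field_simp; linear_combination -h0⟩
  have hν0 : (ν : ZMod p) ≠ 0 := by
    intro h0
    have h3 := congrArg (redMat p) (congrArg (padicMat R φ) (congrArg θ hxx'))
    rw [map_mul, map_mul, map_mul, hX, map_intCast, map_intCast, map_intCast,
      ← map_intCast (algebraMap (ZMod p) (Matrix (Fin 2) (Fin 2) (ZMod p))), h0, map_zero,
      hdet.mul_right_eq_zero] at h3
    have hx'' : x' = (m + n * n' : ℤ) + (-n : ℤ) * ω := by rw [hx']; push_cast; ring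
    rw [hx'', hredx] at h3
    have h4 := congrFun (congrFun h3 0) 1
    have h5 := congrFun (congrFun h3 0) 0
    have hn0 : (n : ZMod p) = 0 := by simpa [ht] using h4
    have hm0 : (m : ZMod p) = 0 := by simpa [hn0] using h5
    exact hbc ⟨by rw [hb, hm0, hn0]; ring, by rw [hc, hn0]; ring⟩
  have hνu : IsUnit (ν : ℤ_[p]) := by rwa [isUnit_iff_toZMod_ne_zero, map_intCast]
  obtain ⟨κ, hκ⟩ := hνu.exists_right_inv
  -- The required unit has `p`-component `x` and its other components are `1`.
  let P : Nat.Primes := ⟨p, hp.out⟩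
  let e : Zhat := Pi.single (M := fun q : Nat.Primes => ℤ_[q]) P 1
  let k : Zhat := Pi.single (M := fun q : Nat.Primes => ℤ_[q]) P κ
  have hee : e * e = e := by rw [← Pi.single_mul, one_mul]
  have hek : e * k = k := by rw [← Pi.single_mul, one_mul]
  have hke : k * e = k := by rw [← Pi.single_mul, mul_one]
  have hνk : ν • k = e := by
    rw [← Pi.single_smul, zsmul_eq_mul]
    exact congrArg (Pi.single (M := fun q : Nat.Primes => ℤ_[q]) P) hκ
  have hkx : k ⊗ₜ[ℤ] (ν : S) = e ⊗ₜ[ℤ] 1 := by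
    rw [← hνk, ← zsmul_one ν, TensorProduct.tmul_smul, TensorProduct.smul_tmul']
  have h6 : e * (1 - e) = 0 := by rw [mul_sub, mul_one, hee, sub_self]
  have h7 : (1 - e) * e = 0 := by rw [sub_mul, one_mul, hee, sub_self]
  have h8 : k * (1 - e) = 0 := by rw [mul_sub, mul_one, hke, sub_self]
  have h9 : (1 - e) * k = 0 := by rw [sub_mul, one_mul, hek, sub_self]
  have h10 : (1 - e) * (1 - e) = 1 - e := by rw [mul_sub, mul_one, h7, sub_zero]
  have hone : e ⊗ₜ[ℤ] (1 : S) + (1 - e) ⊗ₜ[ℤ] 1 = 1 := by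
    rw [← TensorProduct.add_tmul, add_sub_cancel]
    rfl
  refine ⟨⟨e ⊗ₜ[ℤ] x + (1 - e) ⊗ₜ[ℤ] 1, k ⊗ₜ[ℤ] x' + (1 - e) ⊗ₜ[ℤ] 1, ?_, ?_⟩, ?_⟩
  · simp only [add_mul, mul_add, Algebra.TensorProduct.tmul_mul_tmul, hek, h6, h9, h10, mul_one,
      one_mul, TensorProduct.zero_tmul, add_zero, zero_add, hxx', hkx, hone]
  · simp only [add_mul, mul_add, Algebra.TensorProduct.tmul_mul_tmul, hke, h7, h8, h10, mul_one,
      one_mul, TensorProduct.zero_tmul, add_zero, zero_add, mul_comm x' x, hxx', hkx, hone]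
  · change cmRed φ θ (e ⊗ₜ[ℤ] x + (1 - e) ⊗ₜ[ℤ] 1) = _
    have heP : e ⟨p, hp.out⟩ = 1 := Pi.single_eq_same _ _
    have heP' : (1 - e) ⟨p, hp.out⟩ = 0 :=
      (congrArg (fun y : ℤ_[p] => 1 - y) heP).trans (sub_self 1)
    rw [map_add, cmRed_tmul, cmRed_tmul, heP, heP', hX]
    have h11 : PadicInt.toZMod (1 : ℤ_[p]) = 1 := map_one _
    have h12 : PadicInt.toZMod (0 : ℤ_[p]) = 0 := map_zero _
    erw [h11, h12]
    rw [one_smul, zero_smul, add_zero]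

end QuadraticOrder

/-! ### Sums over cosets -/

section CosetSums
variable {G : Type*} [Group G] {N L : Subgroup G} {I X : Type*} [AddCommMonoid X]

/-- If the fibres of a surjection `π : G → I` are the left cosets of `L` and `N ≤ L`, then a sum over
`G / N` of a function that factors through `π` is `[L : N]` times the sum over `I`. -/
theorem sum_quotient_eq_relIndex_smul [Fintype (G ⧸ N)] [Fintype I] (hNL : N ≤ L) {π : G → I}
    (hsurj : Function.Surjective π) (hπ : ∀ a b, π a = π b ↔ a⁻¹ * b ∈ L) {f : G → X} {F : I → X}
    (hf : ∀ a, f a = F (π a)) : ∑ x : G ⧸ N, f x.out = N.relIndex L • ∑ i, F i := by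
  classical
  let e : G ⧸ L → I := Quotient.lift π fun a b hab => (hπ a b).2 (QuotientGroup.leftRel_apply.1 hab)
  have he : Function.Bijective e := by
    constructor
    · intro x y
      induction x using QuotientGroup.induction_on
      induction y using QuotientGroup.induction_on
      intro h
      exact QuotientGroup.eq.2 ((hπ _ _).1 h)
    · intro i
      obtain ⟨a, rfl⟩ := hsurj i
      exact ⟨a, rfl⟩
  let E := Subgroup.quotientEquivProdOfLE hNL
  have hE : ∀ x : G ⧸ N, f x.out = F (e (E x).1) := by
    intro x
    conv_rhs => rw [← QuotientGroup.out_eq' x]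
    exact hf _
  have : Fintype (G ⧸ L) := Fintype.ofBijective _ (Equiv.ofBijective e he).symm.bijective
  have : Fintype (L ⧸ N.subgroupOf L) := by
    have : Finite (L ⧸ N.subgroupOf L) :=
      Finite.of_surjective (fun x => (E x).2) fun y =>
        ⟨E.symm (QuotientGroup.mk 1, y), congrArg Prod.snd (E.apply_symm_apply _)⟩
    exact Fintype.ofFinite _
  calc ∑ x : G ⧸ N, f x.out = ∑ x : (G ⧸ L) × (L ⧸ N.subgroupOf L), F (e x.1) :=
        Fintype.sum_equiv E _ _ hE
    _ = ∑ y : G ⧸ L, N.relIndex L • F (e y) := by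
      rw [Fintype.sum_prod_type]
      refine Finset.sum_congr rfl fun y _ => ?_
      dsimp only
      rw [Finset.sum_const, Finset.card_univ, Subgroup.relIndex, Subgroup.index,
        Nat.card_eq_fintype_card]
    _ = N.relIndex L • ∑ i, F i := by
      rw [← Finset.smul_sum]
      congr 1
      exact Fintype.sum_bijective e he _ _ fun _ => rfl

end CosetSums

/-! ### Classes on Shimura curves and the uniformization -/

section Classes
variable {B : Type*} [Ring B] [Algebra ℚ B] {ψ : ℝ ⊗[ℚ] B ≃ₐ[ℝ] Matrix (Fin 2) (Fin 2) ℝ}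
  {U V : Subgroup (Hat B)ˣ}

/-- The diagonal embedding `Bˣ → B̂ˣ`. -/
def diagUnits (B : Type*) [Ring B] : Bˣ →* (Hat B)ˣ := Units.map (toHat B : B →* Hat B)

theorem cls_mul_right {x : ExtPlanes ψ} {b u : (Hat B)ˣ} (hu : u ∈ U) :
    cls U x (b * u) = cls U x b :=
  (Quotient.sound ⟨1, u, hu, by simp, by simp⟩ : cls U x b = cls U x (b * u)).symm

theorem cls_smul (β : Bˣ) (x : ExtPlanes ψ) (b : (Hat B)ˣ) :
    cls U (β • x) (diagUnits B β * b) = cls U x b :=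
  (Quotient.sound ⟨β, 1, U.one_mem, rfl, by simp [diagUnits]⟩ :
    cls U x b = cls U (β • x) (diagUnits B β * b)).symm

theorem unif_cosetPoint (x : HStar ψ) (γ : normOne ψ) :
    unif ψ U (cosetPoint (gam ψ U) x (Quotient.mk'' γ)) =
      cls U x.1 (diagUnits B (γ⁻¹ : normOne ψ)) := by
  change cls U ((γ : Bˣ) • x.1) 1 = _
  rw [← cls_smul (γ : Bˣ) x.1]
  rw [← map_mul]
  simp

theorem doubleCosetCorr_single {G S : Type*} [Group G] [MulAction G S] (Γ' Γ : Subgroup G) (g : G)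
    (x : S) : doubleCosetCorr Γ' g Γ (Finsupp.single (Quotient.mk'' x) 1) = cosetDiv Γ' g Γ x := by
  rw [doubleCosetCorr, Finsupp.liftAddHom_apply_single, zmultiplesHom_apply, one_smul]
  rfl

/-- The correspondence `Γ_V · 1 · Γ_U` in adelic terms. Let `τ : G → B̂ˣ` be a homomorphism such
that the cosets of `V` which meet `U` are represented in `τ(G)`, and that those which meet `τ(G)` are
represented in `Γ_U`. Then the points of the divisor attached to `x` are the `[x, τ a]`, with `a` in
`G` modulo `τ⁻¹(V)`: the right coset of `γ⁻¹`, for `γ ∈ Γ_U`, corresponds to the `a`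
with `τ a ∈ γ V`. -/
theorem relIndex_smul_curveCorr_single {G : Type*} [Group G] {N : Subgroup G} [Fintype (G ⧸ N)]
    (τ : G →* (Hat B)ˣ) (hN : N ≤ V.comap τ)
    (h1 : ∀ u ∈ U, ∃ a, (τ a)⁻¹ * u ∈ V)
    (h2 : ∀ a, ∃ γ : normOne ψ, γ ∈ gam ψ U ∧ (diagUnits B γ)⁻¹ * τ a ∈ V) (x : HStar ψ) :
    N.relIndex (V.comap τ) • curveCorr ψ V U (Finsupp.single (Quotient.mk'' x) 1) =
      ∑ a : G ⧸ N, Finsupp.single (cls V x.1 (τ a.out)) 1 := by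
  choose γ hγ hγ' using h2
  have hmem : ∀ a, (Quotient.mk'' (γ a)⁻¹ : Quotient (QuotientGroup.rightRel (gam ψ V))) ∈
      cosetsIn (gam ψ V) 1 (gam ψ U) := fun a => ⟨_, DoubleCoset.mem_doubleCoset.2
        ⟨1, (gam ψ V).one_mem, (γ a)⁻¹, (gam ψ U).inv_mem (hγ a), by simp⟩, rfl⟩
  let π : G → cosetsIn (gam ψ V) 1 (gam ψ U) := fun a => ⟨_, hmem a⟩
  have hπ : ∀ a b, π a = π b ↔ a⁻¹ * b ∈ V.comap τ := by
    intro a b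
    rw [Subtype.ext_iff, Quotient.eq'', QuotientGroup.rightRel_apply, inv_inv]
    have h3 : diagUnits B ((γ b)⁻¹ * γ a : normOne ψ) = ((diagUnits B (γ b))⁻¹ * τ b) *
        (τ (a⁻¹ * b))⁻¹ * ((diagUnits B (γ a))⁻¹ * τ a)⁻¹ := by
      rw [Subgroup.coe_mul, map_mul, Subgroup.coe_inv, map_inv, map_mul, map_inv]
      group
    change diagUnits B ((γ b)⁻¹ * γ a : normOne ψ) ∈ V ↔ τ (a⁻¹ * b) ∈ V
    rw [h3, V.mul_mem_cancel_right (V.inv_mem (hγ' a)), V.mul_mem_cancel_left (hγ' b), inv_mem_iff]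
  have hsurj : Function.Surjective π := by
    rintro ⟨_, α, hα, rfl⟩
    obtain ⟨s, hs, g, hg, rfl⟩ := DoubleCoset.mem_doubleCoset.1 hα
    obtain ⟨a, ha⟩ := h1 (diagUnits B ((g⁻¹ : normOne ψ) : Bˣ)) ((gam ψ U).inv_mem hg)
    refine ⟨a, Subtype.ext ?_⟩
    rw [Quotient.eq'', QuotientGroup.rightRel_apply, inv_inv, mul_one, mul_assoc]
    refine (gam ψ V).mul_mem hs ?_
    change diagUnits B (g * γ a : normOne ψ) ∈ V
    have h3 : diagUnits B (g * γ a : normOne ψ) = (((diagUnits B (γ a))⁻¹ * τ a) *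
        ((τ a)⁻¹ * diagUnits B ((g⁻¹ : normOne ψ) : Bˣ)))⁻¹ := by
      rw [Subgroup.coe_mul, map_mul, Subgroup.coe_inv, map_inv]
      group
    rw [h3]
    exact V.inv_mem (V.mul_mem (hγ' a) ha)
  have : Finite (cosetsIn (gam ψ V) 1 (gam ψ U)) := by
    let π' : G ⧸ N → cosetsIn (gam ψ V) 1 (gam ψ U) := fun a => π a.out
    refine Finite.of_surjective π' fun c => ?_
    obtain ⟨a, rfl⟩ := hsurj c
    refine ⟨a, (hπ _ _).2 (hN ?_)⟩
    rw [← QuotientGroup.eq, QuotientGroup.out_eq']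
  have := Fintype.ofFinite (cosetsIn (gam ψ V) 1 (gam ψ U))
  refine Eq.trans ?_ (sum_quotient_eq_relIndex_smul (N := N) (L := V.comap τ) hN hsurj hπ
    (f := fun a => Finsupp.single (cls V x.1 (τ a)) (1 : ℤ))
    (F := fun c => Finsupp.single (unif ψ V (cosetPoint (gam ψ V) x c.1)) (1 : ℤ)) ?_).symm
  · rw [curveCorr, AddMonoidHom.comp_apply, doubleCosetCorr_single, cosetDiv,
      ← finsum_set_coe_eq_finsum_mem, finsum_eq_sum_of_fintype, map_sum]
    congr 1
    refine Finset.sum_congr rfl fun c _ => ?_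
    exact Finsupp.mapDomain_single
  · intro a
    congr 1
    change _ = unif ψ V (cosetPoint (gam ψ V) x (Quotient.mk'' (γ a)⁻¹))
    rw [unif_cosetPoint, inv_inv]
    have h3 := cls_mul_right (x := x.1) (b := diagUnits B (γ a)) (hγ' a)
    rwa [mul_inv_cancel_left] at h3

/-- A matrix `a + b M` fixes the fixed points of `M`. -/
theorem toGL_smul_eq_of_eq_add_smul {β ω : Bˣ} {z : NonReal} (hfix : toGL ψ ω • z = z) {a b : ℚ}
    (hβ : (β : B) = algebraMap ℚ B a + b • (ω : B)) : toGL ψ β • z = z := by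
  have hmat : ∀ γ : Bˣ, ((toGL ψ γ : GL (Fin 2) ℝ) : Matrix (Fin 2) (Fin 2) ℝ) = realMat ψ γ :=
    fun _ => rfl
  have h1 : moeb (toGL ψ ω : Matrix (Fin 2) (Fin 2) ℝ) z.1 = z.1 := congrArg Subtype.val hfix
  rw [moeb, div_eq_iff (moebDen_ne_zero _ z.2), moebDen, hmat] at h1
  apply Subtype.ext
  change moeb (toGL ψ β : Matrix (Fin 2) (Fin 2) ℝ) z.1 = z.1
  rw [moeb, div_eq_iff (moebDen_ne_zero _ z.2), moebDen, hmat, hβ, map_add, AlgHom.commutes,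
    map_smul, Matrix.algebraMap_eq_diagonal]
  simp
  simp only [Rat.smul_def]
  linear_combination (b : ℂ) * h1

end Classes

/-! ### Cartan levels of the units of a quadratic order -/

section CMUnits
variable {K : Type*} [Field K] {S S' : Subring K} {p : ℕ} [hp : Fact p.Prime] {ε : ℤ}
  {B : Type*} [Ring B] {R : Subring B}
  {φ : ℤ_[p] ⊗[ℤ] R ≃ₐ[ℤ_[p]] Matrix (Fin 2) (Fin 2) ℤ_[p]}

/-- The map `Ŝˣ → B̂ˣ` given by a homomorphism `θ : S → R`. -/
def cmUnits (θ : S →+* R) : (Hat S)ˣ →* (Hat B)ˣ :=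
  (hatIncl R).comp (Units.map (hatMap θ : Hat S →* Hat R))

theorem mem_Ms_of_redMat_eq (m m' : Matrix (Fin 2) (Fin 2) ℤ_[p]) (h : redMat p m = redMat p m')
    (hm : m ∈ Ms p) : m' ∈ Ms p := by
  have h' : ∀ i j, (m i j).toZMod = (m' i j).toZMod := fun i j => congrFun (congrFun h i) j
  simpa only [Ms, Submonoid.mem_mk, Subsemigroup.mem_mk, Set.mem_ofPred_eq, h'] using hm

theorem mem_MsPlus_of_redMat_eq (m m' : Matrix (Fin 2) (Fin 2) ℤ_[p]) (h : redMat p m = redMat p m')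
    (hm : m ∈ MsPlus p) : m' ∈ MsPlus p := by
  have h' : ∀ i j, (m i j).toZMod = (m' i j).toZMod := fun i j => congrFun (congrFun h i) j
  simpa only [MsPlus, Submonoid.mem_mk, Subsemigroup.mem_mk, Set.mem_ofPred_eq, h'] using hm

theorem mem_MnsPlus_of_redMat_eq (m m' : Matrix (Fin 2) (Fin 2) ℤ_[p]) (h : redMat p m = redMat p m')
    (hm : m ∈ MnsPlus p ε) : m' ∈ MnsPlus p ε := by
  have h' : ∀ i j, (m i j).toZMod = (m' i j).toZMod := fun i j => congrFun (congrFun h i) j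
  simpa only [MnsPlus, Submonoid.mem_mk, Subsemigroup.mem_mk, Set.mem_ofPred_eq, h'] using hm

theorem mem_MsPlus_of_redMat_apply {m : Matrix (Fin 2) (Fin 2) ℤ_[p]}
    (h : (redMat p m 0 1 = 0 ∧ redMat p m 1 0 = 0) ∨ (redMat p m 0 0 = 0 ∧ redMat p m 1 1 = 0)) :
    m ∈ MsPlus p := h

variable {θ : S →+* R}

theorem cmUnits_mem_Ms_iff (h1 : ∀ x, padicMat R φ (θ x) ∈ Mns p ε) (a : (Hat S)ˣ) :
    cmUnits θ a ∈ hatLevelUnits R φ (Ms p) ↔ cmRed φ θ a 0 1 = 0 := by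
  refine (hatIncl_mem_hatLevelUnits_iff mem_Ms_of_redMat_eq _).trans
    (?_ : (cmRed φ θ a 0 1 = 0 ∧ cmRed φ θ a 1 0 = 0) ↔ _)
  rw [← (cmRed_mem_ns h1 (a : Hat S)).2]
  exact ⟨fun h => h.1, fun h => ⟨h, by rw [h, zero_mul]⟩⟩

theorem cmUnits_mem_MsPlus_iff (a : (Hat S)ˣ) :
    cmUnits θ a ∈ hatLevelUnits R φ (MsPlus p) ↔ (cmRed φ θ a 0 1 = 0 ∧ cmRed φ θ a 1 0 = 0) ∨
      (cmRed φ θ a 0 0 = 0 ∧ cmRed φ θ a 1 1 = 0) :=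
  hatIncl_mem_hatLevelUnits_iff mem_MsPlus_of_redMat_eq _

theorem cmUnits_mem_Ms_iff_hatIncl_mem (hSS : S' ≤ S) (h1 : ∀ x, padicMat R φ (θ x) ∈ Mns p ε)
    (h2 : ∀ x : S, padicMat R φ (θ x) ∈ Ms p ↔ (x : K) ∈ S') {ω : S} (hωS : (ω : K) ∉ S')
    (hω : ∀ x : S, ∃ m n : ℤ, x = m + n * ω) (a : (Hat S)ˣ) :
    cmUnits θ a ∈ hatLevelUnits R φ (Ms p) ↔
      hatIncl S a ∈ (hatSubring S').toSubmonoid.units := by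
  have key : ∀ a : (Hat S)ˣ, cmUnits θ a ∈ hatLevelUnits R φ (Ms p) ↔
      ((hatIncl S a : (Hat K)ˣ) : Hat K) ∈ hatSubring S' := by
    intro a
    rw [cmUnits_mem_Ms_iff h1, ← exists_hatMap_inclusion_eq_iff hSS h1 h2 hωS hω]
    refine exists_congr fun y => ?_
    rw [← (hatMap_injective (g := S.subtype) Subtype.val_injective).eq_iff, hatMap_hatMap]
    rfl
  rw [Submonoid.mem_units_iff]
  refine ⟨fun h => ⟨(key a).1 h, ?_⟩, fun h => (key a).2 h.1⟩
  have := (key a⁻¹).1 (by rw [map_inv]; exact inv_mem h)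
  rwa [map_inv] at this

/-- The elements of the non-split Cartan group that lie in `M_s+` are the scalars and the antidiagonal
matrices, and the latter form one coset of the scalars. -/
theorem relIndex_comap_cmUnits_eq_two (hε : ¬IsSquare (ε : ZMod p))
    (h1 : ∀ x, padicMat R φ (θ x) ∈ Mns p ε)
    (h2 : ∀ x : S, padicMat R φ (θ x) ∈ Ms p ↔ (x : K) ∈ S') {ω : S} (hωS : (ω : K) ∉ S')
    (hω : ∀ x : S, ∃ m n : ℤ, x = m + n * ω) :
    ((hatLevelUnits R φ (Ms p)).comap (cmUnits θ)).relIndex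
      ((hatLevelUnits R φ (MsPlus p)).comap (cmUnits θ)) = 2 := by
  obtain ⟨a, ha⟩ := exists_cmRed_eq hε h1 h2 hωS hω (b := 0) (c := 1) (by simp)
  refine Subgroup.relIndex_eq_two_iff_exists_notMem_and.2 ⟨a, ?_, ?_, fun b hb => ?_⟩
  · rw [Subgroup.mem_comap, cmUnits_mem_MsPlus_iff, ha]
    simp
  · rw [Subgroup.mem_comap, cmUnits_mem_Ms_iff h1, ha]
    simp
  · rw [Subgroup.mem_comap, cmUnits_mem_MsPlus_iff] at hb
    rw [Subgroup.mem_comap, Subgroup.mem_comap, cmUnits_mem_Ms_iff h1, cmUnits_mem_Ms_iff h1]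
    rcases hb with hb | hb
    · exact Or.inr hb.1
    · left
      rw [Units.val_mul, map_mul, ha, Matrix.mul_apply, Fin.sum_univ_two, hb.1]
      simp

/-- If `y` reduces to `ι(a) D` modulo `p` with `D ∈ M_s+`, then `y ∈ ι̂(a) R̂_s+ˣ`. -/
theorem cmUnits_inv_mul_hatIncl_mem (a : (Hat S)ˣ) (y : (Hat R)ˣ)
    {D : Matrix (Fin 2) (Fin 2) (ZMod p)}
    (hD : redMat p (hatMat R φ (y : Hat R)) = cmRed φ θ a * D)
    (hD' : (D 0 1 = 0 ∧ D 1 0 = 0) ∨ (D 0 0 = 0 ∧ D 1 1 = 0)) :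
    (cmUnits θ a)⁻¹ * hatIncl R y ∈ hatLevelUnits R φ (MsPlus p) := by
  have : (cmUnits θ a)⁻¹ * hatIncl R y =
      hatIncl R (Units.map (hatMap θ : Hat S →* Hat R) a⁻¹ * y) := by
    rw [map_mul, ← map_inv]
    rfl
  rw [this, hatIncl_mem_hatLevelUnits_iff mem_MsPlus_of_redMat_eq]
  apply mem_MsPlus_of_redMat_apply
  have hred : redMat p (hatMat R φ ((Units.map (hatMap θ : Hat S →* Hat R) a⁻¹ * y : (Hat R)ˣ) :
      Hat R)) = D := by
    rw [Units.val_mul, map_mul, map_mul, hD]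
    change cmRed φ θ (a⁻¹ : (Hat S)ˣ) * (cmRed φ θ a * D) = D
    rw [← mul_assoc, ← map_mul, Units.inv_mul, map_one, one_mul]
  rwa [hred]

/-- Each coset of `R̂_s+ˣ` that meets `R̂_ns+ˣ` is represented by a unit of `Ŝ`. -/
theorem exists_cmUnits_inv_mul_mem (hε : ¬IsSquare (ε : ZMod p))
    (h1 : ∀ x, padicMat R φ (θ x) ∈ Mns p ε)
    (h2 : ∀ x : S, padicMat R φ (θ x) ∈ Ms p ↔ (x : K) ∈ S') {ω : S} (hωS : (ω : K) ∉ S')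
    (hω : ∀ x : S, ∃ m n : ℤ, x = m + n * ω) {u : (Hat B)ˣ}
    (hu : u ∈ hatLevelUnits R φ (MnsPlus p ε)) :
    ∃ a, (cmUnits θ a)⁻¹ * u ∈ hatLevelUnits R φ (MsPlus p) := by
  obtain ⟨y, rfl⟩ := exists_hatIncl_eq hu
  rw [hatIncl_mem_hatLevelUnits_iff mem_MnsPlus_of_redMat_eq] at hu
  have hX : IsUnit (redMat p (hatMat R φ (y : Hat R))) :=
    (y.isUnit.map (hatMat R φ)).map (redMat p)
  have key := fun a D => cmUnits_inv_mul_hatIncl_mem (φ := φ) (θ := θ) a y (D := D)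
  change ((redMat p (hatMat R φ y) 0 0 = redMat p (hatMat R φ y) 1 1 ∧
    redMat p (hatMat R φ y) 0 1 * (ε : ZMod p) = redMat p (hatMat R φ y) 1 0) ∨
    (redMat p (hatMat R φ y) 0 0 = -redMat p (hatMat R φ y) 1 1 ∧
    -redMat p (hatMat R φ y) 0 1 * (ε : ZMod p) = redMat p (hatMat R φ y) 1 0)) at hu
  generalize redMat p (hatMat R φ (y : Hat R)) = X at *
  have hX0 : ¬(X 0 0 = 0 ∧ X 0 1 = 0) := by
    rintro ⟨h3, h4⟩
    rw [Matrix.isUnit_iff_isUnit_det, Matrix.det_fin_two, h3, h4, isUnit_iff_ne_zero] at hX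
    simp at hX
  rcases hu with ⟨h3, h4⟩ | ⟨h3, h4⟩
  · obtain ⟨a, ha⟩ := exists_cmRed_eq hε h1 h2 hωS hω hX0
    refine ⟨a, key a 1 ?_ (by simp)⟩
    rw [ha, mul_one]
    ext i j
    fin_cases i <;> fin_cases j <;> simp [h3, h4]
  -- A matrix of `M_ns+` which is not in `M_ns` is in `M_ns · diag(1, -1)`.
  · obtain ⟨a, ha⟩ := exists_cmRed_eq hε h1 h2 hωS hω (b := X 0 0) (c := -X 0 1)
      (by rwa [neg_eq_zero])
    refine ⟨a, key a !![1, 0; 0, -1] ?_ (by simp)⟩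
    rw [ha, Matrix.mul_fin_two]
    ext i j
    fin_cases i <;> fin_cases j <;> simp [h3, ← h4]

/-- A non-square `ε` generates the square classes of `𝔽_p`. -/
theorem isSquare_or_isSquare_mul (hp2 : p ≠ 2) (hε : ¬IsSquare (ε : ZMod p)) (x : ZMod p) :
    ∃ k, x = k * k ∨ x = k * k * ε := by
  by_cases hx : IsSquare x
  · obtain ⟨k, hk⟩ := hx
    exact ⟨k, Or.inl hk⟩
  · have hch : ringChar (ZMod p) ≠ 2 := by rwa [ZMod.ringChar_zmod_n]
    have hx0 : x ≠ 0 := by rintro rfl; exact hx IsSquare.zero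
    have hε0 : (ε : ZMod p) ≠ 0 := by intro h; exact hε (h ▸ IsSquare.zero)
    have h1 := (quadraticChar_neg_one_iff_not_isSquare).2 hx
    have h2 := (quadraticChar_neg_one_iff_not_isSquare).2 hε
    have h3 : quadraticChar (ZMod p) (x * ε) = 1 := by rw [map_mul, h1, h2]; norm_num
    obtain ⟨k, hk⟩ := (quadraticChar_one_iff_isSquare (mul_ne_zero hx0 hε0)).1 h3
    refine ⟨k / ε, Or.inr ?_⟩
    field_simp
    linear_combination hk

/-- Each coset of `R̂_s+ˣ` represented by a unit of `Ŝ` is represented by an element of `Γ_ns+`. -/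
theorem exists_gam_inv_mul_mem [Algebra ℚ B] [Algebra.IsCentral ℚ B]
    (ψ : ℝ ⊗[ℚ] B ≃ₐ[ℝ] Matrix (Fin 2) (Fin 2) ℝ)
    (hRfg : (AddSubgroup.toIntSubmodule R.toAddSubgroup).FG)
    (hRspan : Submodule.span ℚ (R : Set B) = ⊤) (hp2 : p ≠ 2) (hε : ¬IsSquare (ε : ZMod p))
    (h1 : ∀ x, padicMat R φ (θ x) ∈ Mns p ε) (a : (Hat S)ˣ) :
    ∃ γ : normOne ψ, γ ∈ gam ψ (hatLevelUnits R φ (MnsPlus p ε)) ∧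
      (diagUnits B γ)⁻¹ * cmUnits θ a ∈ hatLevelUnits R φ (MsPlus p) := by
  obtain ⟨h3, h4⟩ := cmRed_mem_ns h1 (a : Hat S)
  have hXu : IsUnit (cmRed φ θ a) := a.isUnit.map (cmRed φ θ)
  have hdet : (cmRed φ θ a).det ≠ 0 := by
    rwa [Matrix.isUnit_iff_isUnit_det, isUnit_iff_ne_zero] at hXu
  have key : ∀ D : Matrix (Fin 2) (Fin 2) (ZMod p), (cmRed φ θ a * D).det = 1 →
      (((cmRed φ θ a * D) 0 0 = (cmRed φ θ a * D) 1 1 ∧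
        (cmRed φ θ a * D) 0 1 * (ε : ZMod p) = (cmRed φ θ a * D) 1 0) ∨
       ((cmRed φ θ a * D) 0 0 = -(cmRed φ θ a * D) 1 1 ∧
        -(cmRed φ θ a * D) 0 1 * (ε : ZMod p) = (cmRed φ θ a * D) 1 0)) →
      ((D 0 1 = 0 ∧ D 1 0 = 0) ∨ (D 0 0 = 0 ∧ D 1 1 = 0)) →
      ∃ γ : normOne ψ, γ ∈ gam ψ (hatLevelUnits R φ (MnsPlus p ε)) ∧
        (diagUnits B γ)⁻¹ * cmUnits θ a ∈ hatLevelUnits R φ (MsPlus p) := by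
    intro D hD1 hD2 hD3
    obtain ⟨g, hg, hgD⟩ := sl_two_subset_normOneImage_padicMat ψ hp2 hε hRfg hRspan φ _ hD1
    change redMat p (padicMat R φ (g : R)) = _ at hgD
    have hdiag : diagUnits B (Units.map (R.subtype : R →* B) g) =
        hatIncl R (Units.map (toHat R : R →* Hat R) g) := Units.ext rfl
    refine ⟨⟨Units.map (R.subtype : R →* B) g, Units.ext hg⟩, ?_, ?_⟩
    · change diagUnits B (Units.map (R.subtype : R →* B) g) ∈ hatLevelUnits R φ (MnsPlus p ε)
      rw [hdiag, hatIncl_mem_hatLevelUnits_iff mem_MnsPlus_of_redMat_eq]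
      rw [← hgD] at hD2
      exact hD2
    · change (diagUnits B (Units.map (R.subtype : R →* B) g))⁻¹ * _ ∈
        hatLevelUnits R φ (MsPlus p)
      rw [hdiag, ← inv_mem_iff, mul_inv_rev, inv_inv]
      exact cmUnits_inv_mul_hatIncl_mem a _ hgD hD3
  -- The determinants of the elements of `M_s+ ∩ M_ns+` exhaust `𝔽_pˣ`: those of the scalars are the
  -- squares and those of the matrices `(0, k; -k ε, 0)` are the squares times `ε`.
  obtain ⟨k, hk | hk⟩ := isSquare_or_isSquare_mul hp2 hε (cmRed φ θ a).det⁻¹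
  · refine key !![k, 0; 0, k] ?_ (Or.inl ?_) (by simp)
    · rw [Matrix.det_mul, Matrix.det_fin_two_of, mul_zero, sub_zero, ← hk, mul_inv_cancel₀ hdet]
    · simp [Matrix.mul_apply, Fin.sum_univ_two, h3, ← h4]
      ring
  · refine key !![0, k; -(k * ε), 0] ?_ (Or.inr ?_) (by simp)
    · have h5 := mul_inv_cancel₀ hdet
      rw [hk] at h5
      rw [Matrix.det_mul, Matrix.det_fin_two_of]
      linear_combination h5
    · simp [Matrix.mul_apply, Fin.sum_univ_two, h3, ← h4]
      constructor <;> ring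

theorem finiteIndex_comap_cmUnits (h1 : ∀ x, padicMat R φ (θ x) ∈ Mns p ε) :
    ((hatLevelUnits R φ (Ms p)).comap (cmUnits θ)).FiniteIndex := by
  let ρ : (Hat S)ˣ →* (Matrix (Fin 2) (Fin 2) (ZMod p))ˣ :=
    Units.map (cmRed φ θ : Hat S →* Matrix (Fin 2) (Fin 2) (ZMod p))
  refine Subgroup.finiteIndex_of_le (H := ρ.ker) fun a ha => ?_
  have : cmRed φ θ a = 1 := congrArg Units.val ha
  rw [Subgroup.mem_comap, cmUnits_mem_Ms_iff h1, this]
  simp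

end CMUnits

/-! ### Orders of an imaginary quadratic field -/

section Orders
variable {K : Type*} [Field K]

theorem conductorOrder_mul_le (p f : ℕ) : conductorOrder K (p * f) ≤ conductorOrder K f := by
  rintro _ ⟨n, a, rfl⟩
  exact ⟨n, p * a, by push_cast; ring⟩

variable [NumberField K]

theorem exists_natCast_mul_mem_conductorOrder {f : ℕ} (hf : f ≠ 0) (x : K) :
    ∃ n : ℕ, 0 < n ∧ (n : K) * x ∈ conductorOrder K f := by
  have halg : IsAlgebraic ℤ x :=
    (IsFractionRing.isAlgebraic_iff ℤ ℚ K).2 (Algebra.IsAlgebraic.isAlgebraic x)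
  obtain ⟨z, hz, hx⟩ := halg.exists_integral_multiple
  have hz' : IsIntegral ℤ ((z.natAbs : ℤ) • x) := by
    rcases Int.natAbs_eq z with h | h
    · rwa [← h]
    · rw [show (z.natAbs : ℤ) = -z by omega, neg_smul]
      exact hx.neg
  refine ⟨f * z.natAbs, Nat.mul_pos (Nat.pos_of_ne_zero hf) (Int.natAbs_pos.2 hz), 0,
    ⟨_, hz'⟩, ?_⟩
  simp [mul_assoc]

variable {ω : K} {f p : ℕ}

theorem exists_eq_add_smul (hf : f ≠ 0)
    (hω : (conductorOrder K f : Set K) = {x | ∃ m n : ℤ, x = m + n * ω}) (x : K) :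
    ∃ a b : ℚ, x = algebraMap ℚ K a + b • ω := by
  obtain ⟨n, hn, hx⟩ := exists_natCast_mul_mem_conductorOrder hf x
  rw [← SetLike.mem_coe, hω] at hx
  obtain ⟨k, l, hkl⟩ := hx
  have hn' : (n : K) ≠ 0 := Nat.cast_ne_zero.2 hn.ne'
  refine ⟨k / n, l / n, mul_left_cancel₀ hn' ?_⟩
  rw [hkl, Algebra.smul_def]
  simp
  field_simp

theorem notMem_conductorOrder_mul (hK : Module.finrank ℚ K = 2) (hf : f ≠ 0) (hp : p ≠ 1)
    (hω : (conductorOrder K f : Set K) = {x | ∃ m n : ℤ, x = m + n * ω}) :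
    ω ∉ conductorOrder K (p * f) := by
  rintro ⟨k, a, hka⟩
  have ha : (f : K) * a ∈ (conductorOrder K f : Set K) := ⟨0, a, by simp⟩
  rw [hω] at ha
  obtain ⟨m, n, hmn⟩ := ha
  have hpn : (1 - p * n : ℚ) ≠ 0 := by
    intro h
    have h1 : (p : ℤ) * n = 1 := by exact_mod_cast (sub_eq_zero.1 h).symm
    exact hp (by simpa using Int.eq_one_or_neg_one_of_mul_eq_one h1 |>.resolve_right (by omega))
  have hωq : ω = algebraMap ℚ K ((k + p * m) / (1 - p * n)) := by
    have hpn' : (1 - p * n : K) ≠ 0 := by exact_mod_cast hpn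
    rw [map_div₀]
    simp only [map_add, map_sub, map_mul, map_natCast, map_intCast, map_one]
    rw [eq_div_iff hpn']
    push_cast at hka
    linear_combination hka + p * hmn
  have hsurj : Function.Surjective (algebraMap ℚ K) := by
    intro x
    obtain ⟨c, b, rfl⟩ := exists_eq_add_smul hf hω x
    exact ⟨c + b * ((k + p * m) / (1 - p * n)), by rw [map_add, map_mul, ← hωq, Algebra.smul_def]⟩
  have := finrank_eq_one_iff_of_nonzero' (K := ℚ) (1 : K) one_ne_zero |>.2 fun w => by
    obtain ⟨c, rfl⟩ := hsurj w
    exact ⟨c, by rw [Algebra.smul_def, mul_one]⟩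
  omega

end Orders

/-! ### The sum over the Galois group -/

section Galois
variable {K : Type*} [Field K] {S S' : Subring K}

theorem hat_mul_comm (x y : Hat K) : x * y = y * x := by
  induction x using TensorProduct.induction_on with
  | zero => rw [zero_mul, mul_zero]
  | add a b ha hb => rw [add_mul, mul_add, ha, hb]
  | tmul z a =>
    induction y using TensorProduct.induction_on with
    | zero => rw [zero_mul, mul_zero]
    | add a b ha hb => rw [add_mul, mul_add, ha, hb]
    | tmul w b =>
      rw [Algebra.TensorProduct.tmul_mul_tmul, Algebra.TensorProduct.tmul_mul_tmul, mul_comm z,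
        mul_comm a]

/-- The commutative group structure of `K̂ˣ`, whose group structure is the one of the units of the
ring `K̂`. -/
instance instCommGroupHatUnits : CommGroup (Hat K)ˣ :=
  { (inferInstance : Group (Hat K)ˣ) with
    mul_comm := fun a b => Units.ext (hat_mul_comm (a : Hat K) b) }

theorem comap_diagUnits_units (hS : ∀ x : K, toHat K x ∈ hatSubring S → x ∈ S) :
    (hatSubring S).toSubmonoid.units.comap (diagUnits K) = S.toSubmonoid.units := by
  have key : ∀ x : K, toHat K x ∈ hatSubring S ↔ x ∈ S :=
    fun x => ⟨hS x, fun hx => ⟨toHat S ⟨x, hx⟩, rfl⟩⟩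
  ext u
  rw [Subgroup.mem_comap, Submonoid.mem_units_iff, Submonoid.mem_units_iff, ← map_inv]
  exact and_congr (key _) (key _)

/-- The index of `Ŝ'ˣ` in the subgroup of the elements of `Ŝˣ` that lie in `Kˣ Ŝ'ˣ`. -/
theorem relIndex_comap_hatIncl_eq (hSS : S' ≤ S)
    (hS : ∀ x : K, toHat K x ∈ hatSubring S → x ∈ S)
    (hS' : ∀ x : K, toHat K x ∈ hatSubring S' → x ∈ S') :
    ((hatSubring S').toSubmonoid.units.comap (hatIncl S)).relIndex
      (((diagUnits K).range ⊔ (hatSubring S').toSubmonoid.units).comap (hatIncl S)) =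
    S'.toSubmonoid.units.relIndex S.toSubmonoid.units := by
  have hle : hatSubring S' ≤ hatSubring S := by
    rintro _ ⟨y, rfl⟩
    exact ⟨hatMap (Subring.inclusion hSS) y, hatMap_hatMap _ _ _⟩
  have hrange : (hatIncl S).range = (hatSubring S).toSubmonoid.units := by
    ext u
    exact (mem_units_hatSubring_iff u).symm
  rw [Subgroup.relIndex_comap, Subgroup.map_comap_eq, hrange, inf_comm, sup_comm,
    sup_inf_assoc_of_le _ (Submonoid.units_mono hle), Subgroup.relIndex_sup_left,
    ← Subgroup.map_comap_eq, ← Subgroup.relIndex_comap, comap_diagUnits_units hS,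
    comap_diagUnits_units hS']

/-- If the elements that fix `F` under the Artin map are those of `Kˣ Ŝˣ`, and `Kˣ` is in the kernel
of the Artin map, then `Ŝˣ` maps onto `Gal(H / F)`. The subgroup `D` plays the role of `Kˣ`. -/
theorem exists_surjective_hat_units_to_gal {H : Type*} [Field H] [Algebra K H] {art : (Hat K)ˣ →* (H ≃ₐ[K] H)}
    (hsurj : Function.Surjective art) {D : Subgroup (Hat K)ˣ} (hD : D ≤ art.ker)
    {F : IntermediateField K H}
    (hF : ∀ a : (Hat K)ˣ, (∀ x ∈ F, art a x = x) ↔ a ∈ D ⊔ (hatSubring S).toSubmonoid.units) :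
    ∃ π : (Hat S)ˣ → (H ≃ₐ[F] H), Function.Surjective π ∧
      ∀ a, (π a).restrictScalars K = art (hatIncl S a) := by
  have hex : ∀ a : (Hat S)ˣ, ∃ σ : H ≃ₐ[F] H, σ.restrictScalars K = art (hatIncl S a) := by
    intro a
    have h1 : art (hatIncl S a) ∈ F.fixingSubgroup := by
      rw [IntermediateField.mem_fixingSubgroup_iff]
      exact (hF _).2 (Subgroup.mem_sup_right ((mem_units_hatSubring_iff _).2 ⟨a, rfl⟩))
    exact ⟨F.fixingSubgroupEquiv ⟨_, h1⟩, AlgEquiv.ext fun x => rfl⟩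
  choose π hπ using hex
  refine ⟨π, fun σ => ?_, hπ⟩
  obtain ⟨b, hb⟩ := hsurj (σ.restrictScalars K)
  have hb' : b ∈ D ⊔ (hatSubring S).toSubmonoid.units := by
    rw [← hF, hb]
    exact fun x hx => σ.commutes ⟨x, hx⟩
  obtain ⟨k, hk, v, hv, rfl⟩ := Subgroup.mem_sup.1 hb'
  obtain ⟨a, rfl⟩ := (mem_units_hatSubring_iff v).1 hv
  refine ⟨a, AlgEquiv.restrictScalars_injective K ?_⟩
  rw [hπ, ← hb, map_mul, (hD hk : art k = 1), one_mul]

end Galois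

/-! ### The CM points -/

section CMPoints
variable {K : Type*} [Field K] {S S' : Subring K} {p : ℕ} [hp : Fact p.Prime] {ε : ℤ}
  {B : Type*} [Ring B] {R : Subring B}
  {φ : ℤ_[p] ⊗[ℤ] R ≃ₐ[ℤ_[p]] Matrix (Fin 2) (Fin 2) ℤ_[p]}

/-- The map `K̂ˣ → B̂ˣ` induced by `ι`. -/
def hatUnits (ι : K →+* B) : (Hat K)ˣ →* (Hat B)ˣ := Units.map (hatMap ι : Hat K →* Hat B)

theorem hatUnits_hatIncl {ι : K →+* B} {θ : S →+* R} (hθ : ∀ x : S, (θ x : B) = ι x)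
    (a : (Hat S)ˣ) : hatUnits ι (hatIncl S a) = cmUnits θ a := by
  apply Units.ext
  change hatMap ι (hatMap S.subtype (a : Hat S)) = hatMap R.subtype (hatMap θ (a : Hat S))
  rw [hatMap_hatMap, hatMap_hatMap]
  congr 1
  exact congrArg _ (RingHom.ext fun x => (hθ x).symm)

theorem hatUnits_diagUnits (ι : K →+* B) (k : Kˣ) :
    hatUnits ι (diagUnits K k) = diagUnits B (Units.map (ι : K →* B) k) := Units.ext rfl

variable [Algebra ℚ B] {ψ : ℝ ⊗[ℚ] B ≃ₐ[ℝ] Matrix (Fin 2) (Fin 2) ℝ}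

/-- The class `[z, ι̂(a)]` depends only on the class of `a` modulo `Kˣ Ŝ'ˣ`, if `Kˣ` fixes `z` and
`ι̂` maps `Ŝ'ˣ` to `U`. -/
theorem cls_hatUnits_eq {U : Subgroup (Hat B)ˣ} {ι : K →+* B} {z : ExtPlanes ψ}
    (hfix : ∀ k : Kˣ, Units.map (ι : K →* B) k • z = z)
    (hU : ∀ v ∈ (hatSubring S').toSubmonoid.units, hatUnits ι v ∈ U) {a b : (Hat K)ˣ}
    (hab : a⁻¹ * b ∈ (diagUnits K).range ⊔ (hatSubring S').toSubmonoid.units) :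
    cls U z (hatUnits ι a) = cls U z (hatUnits ι b) := by
  obtain ⟨_, ⟨k, rfl⟩, v, hv, h⟩ := Subgroup.mem_sup.1 hab
  have hb : b = diagUnits K k * a * v := by
    rw [mul_comm _ a, mul_assoc, h, mul_inv_cancel_left]
  rw [hb, map_mul, map_mul, cls_mul_right (hU v hv), hatUnits_diagUnits]
  conv_rhs => rw [← hfix k]
  exact (cls_smul _ _ _).symm

end CMPoints
end CartanCM
end

open CartanCM in
theorem proposition3p4
    -- the prime and the non-residue
    (p : ℕ) [hp : Fact p.Prime] (hp2 : p ≠ 2) (ε : ℤ) (hε : ¬ IsSquare (ε : ZMod p))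
    -- an imaginary quadratic field in which p is inert
    (K : Type*) [Field K] [NumberField K] [NumberField.IsTotallyComplex K]
    (hK : Module.finrank ℚ K = 2)
    (hinert : (Ideal.span {(p : NumberField.RingOfIntegers K)}).IsPrime)
    (f : ℕ) (hf : f.Coprime p)
    -- an indefinite quaternion algebra, split at p
    (B : Type*) [Ring B] [Algebra ℚ B] [IsSimpleRing B] [Algebra.IsCentral ℚ B]
    (hB : Module.finrank ℚ B = 4)
    (ψ : ℝ ⊗[ℚ] B ≃ₐ[ℝ] Matrix (Fin 2) (Fin 2) ℝ)
    -- an order of B which is maximal at p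
    (R : Subring B) (hRfg : (AddSubgroup.toIntSubmodule R.toAddSubgroup).FG)
    (hRspan : Submodule.span ℚ (R : Set B) = ⊤)
    (φ : ℤ_[p] ⊗[ℤ] R ≃ₐ[ℤ_[p]] Matrix (Fin 2) (Fin 2) ℤ_[p])
    -- an embedding of K which is optimal for both Cartan levels
    (ι : K →ₐ[ℚ] B)
    (hns : Set.range ι ∩ level R φ (Mns p ε) = ι '' (conductorOrder K f : Set K))
    (hs : Set.range ι ∩ level R φ (Ms p) = ι '' (conductorOrder K (p * f) : Set K))
    -- the fixed point of ω in the upper half plane, where 𝒪_f = ℤ + ℤ ω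
    (ω : Kˣ) (hω : (conductorOrder K f : Set K) = {x | ∃ m n : ℤ, x = m + n * (ω : K)})
    (z₀ : NonReal) (hz₀ : 0 < z₀.1.im)
    (hfix : toGL ψ (Units.map (ι : K →* B) ω) • z₀ = z₀)
    -- the ring class fields of conductor p f and f
    (H : Type*) [Field H] [NumberField H] [Algebra K H] (art : (Hat K)ˣ →* (H ≃ₐ[K] H))
    (hH : IsRingClassField K (p * f) H art)
    (F : IntermediateField K H) (hF : IsRingClassSubfield K f art F) :
    -- the Galois conjugates of the CM point of conductor p f are well defined on X_s
    ∃ Q : (H ≃ₐ[K] H) → ShimuraCurve ψ (hatLevelUnits R φ (Ms p)),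
      (∀ a : (Hat K)ˣ, Q (art a) =
        cls _ (ofNonReal z₀) (Units.map (hatMap (ι : K →+* B) : Hat K →* Hat B) a)) ∧
      -- twice the image of Q_f (the point of Γ_ns+ \ ℋ* given by z₀, see unif_upperPoint) under the
      -- correspondence Γ_s+ · 1 · Γ_ns+, with the index of the unit groups
      (2 : ℤ) • curveCorr ψ (hatLevelUnits R φ (MsPlus p)) (hatLevelUnits R φ (MnsPlus p ε))
          (Finsupp.single (upperPoint _ z₀ hz₀) 1) =
        ((conductorUnits K (p * f)).relIndex (conductorUnits K f) : ℤ) •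
          ∑ σ : H ≃ₐ[F] H, Finsupp.single
            (proj ψ (hatLevelUnits_mono R φ (Ms_le p)) (Q (σ.restrictScalars K))) (1 : ℤ) ∧
      -- the same relation when the only units of 𝒪_f are 1 and -1
      ((∀ u ∈ conductorUnits K f, u = 1 ∨ u = -1) →
        (2 : ℤ) • curveCorr ψ (hatLevelUnits R φ (MsPlus p)) (hatLevelUnits R φ (MnsPlus p ε))
            (Finsupp.single (upperPoint _ z₀ hz₀) 1) =
          ∑ σ : H ≃ₐ[F] H, Finsupp.single
            (proj ψ (hatLevelUnits_mono R φ (Ms_le p)) (Q (σ.restrictScalars K))) (1 : ℤ)) := by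
  have hpp := hp.out
  have hf0 : f ≠ 0 := by
    rintro rfl
    exact hpp.one_lt.ne' (Nat.coprime_zero_left p |>.1 hf)
  have hpf0 : p * f ≠ 0 := mul_ne_zero hpp.ne_zero hf0
  have hBnt : Nontrivial B := inferInstance
  have hιinj : Function.Injective ι := ι.toRingHom.injective
  have hSS := conductorOrder_mul_le (K := K) p f
  -- The restriction of `ι` to `𝒪_f` takes values in `R`.
  have hmem : ∀ x ∈ conductorOrder K f, ι x ∈ level R φ (Mns p ε) := fun x hx =>
    (hns.symm ▸ Set.mem_image_of_mem ι hx : ι x ∈ Set.range ι ∩ level R φ (Mns p ε)).2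
  have hmemR : ∀ x : conductorOrder K f,
      ((ι : K →+* B).comp (conductorOrder K f).subtype) x ∈ R := by
    intro x
    obtain ⟨r, hr, -⟩ := hmem x x.2
    exact hr ▸ r.2
  let θ : conductorOrder K f →+* R :=
    ((ι : K →+* B).comp (conductorOrder K f).subtype).codRestrict R hmemR
  have hθ : ∀ x, (θ x : B) = (ι : K →+* B) x := fun _ => rfl
  have hlevel : ∀ (M : Submonoid (Matrix (Fin 2) (Fin 2) ℤ_[p])) (x : conductorOrder K f),
      padicMat R φ (θ x) ∈ M ↔ ι x ∈ level R φ M := by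
    intro M x
    constructor
    · exact fun h => ⟨θ x, rfl, h⟩
    · rintro ⟨r, hr, h⟩
      have hrx : θ x = r := Subtype.ext hr.symm
      rw [hrx]
      exact h
  have h1 : ∀ x, padicMat R φ (θ x) ∈ Mns p ε := fun x => (hlevel _ x).2 (hmem x x.2)
  have h2 : ∀ x, padicMat R φ (θ x) ∈ Ms p ↔ (x : K) ∈ conductorOrder K (p * f) := by
    intro x
    rw [hlevel, ← SetLike.mem_coe, ← hιinj.mem_set_image, ← hs]
    exact ⟨fun h => ⟨⟨x, rfl⟩, h⟩, fun h => h.2⟩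
  have hωmem : (ω : K) ∈ conductorOrder K f := by
    rw [← SetLike.mem_coe, hω]
    exact ⟨0, 1, by simp⟩
  have hω' : ∀ x : conductorOrder K f, ∃ m n : ℤ, x = m + n * ⟨ω, hωmem⟩ := by
    rintro ⟨x, hx⟩
    rw [← SetLike.mem_coe, hω] at hx
    obtain ⟨m, n, rfl⟩ := hx
    exact ⟨m, n, Subtype.ext (by simp)⟩
  have hωS : ((⟨ω, hωmem⟩ : conductorOrder K f) : K) ∉ conductorOrder K (p * f) :=
    notMem_conductorOrder_mul hK hf0 hpp.one_lt.ne' hω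
  -- `Kˣ` fixes `z₀`.
  have hfixK : ∀ k : Kˣ, Units.map ((ι : K →+* B) : K →* B) k • (ofNonReal z₀ : ExtPlanes ψ) =
      ofNonReal z₀ := by
    intro k
    obtain ⟨a, b, hab⟩ := exists_eq_add_smul hf0 hω (k : K)
    refine congrArg Sum.inl (toGL_smul_eq_of_eq_add_smul hfix (a := a) (b := b) ?_)
    change ι k = algebraMap ℚ B a + b • ι ω
    rw [hab, map_add, AlgHom.commutes, map_smul]
  -- `ι̂` maps the units of the profinite completion of `𝒪_pf` to `R̂_sˣ`.
  have hNiff := cmUnits_mem_Ms_iff_hatIncl_mem hSS h1 h2 hωS hω'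
  have hle : (hatSubring (conductorOrder K (p * f))).toSubmonoid.units ≤
      (hatSubring (conductorOrder K f)).toSubmonoid.units := by
    refine Submonoid.units_mono ?_
    rintro _ ⟨y, rfl⟩
    exact ⟨hatMap (Subring.inclusion hSS) y, hatMap_hatMap _ _ _⟩
  have hU : ∀ v ∈ (hatSubring (conductorOrder K (p * f))).toSubmonoid.units,
      hatUnits (ι : K →+* B) v ∈ hatLevelUnits R φ (Ms p) := by
    intro v hv
    obtain ⟨a, rfl⟩ := (mem_units_hatSubring_iff v).1 (hle hv)
    rw [hatUnits_hatIncl hθ]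
    exact (hNiff a).2 hv
  have hker : art.ker = (diagUnits K).range ⊔
    (hatSubring (conductorOrder K (p * f))).toSubmonoid.units := hH.ker_eq
  have hQ : ∀ a b : (Hat K)ˣ, art a = art b →
      cls (hatLevelUnits R φ (Ms p)) (ofNonReal z₀ : ExtPlanes ψ) (hatUnits (ι : K →+* B) a) =
      cls (hatLevelUnits R φ (Ms p)) (ofNonReal z₀) (hatUnits (ι : K →+* B) b) := by
    intro a b hab
    refine cls_hatUnits_eq hfixK hU ?_
    rw [← hker, MonoidHom.mem_ker, map_mul, map_inv, hab, inv_mul_cancel]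
  choose s hs' using hH.surjective
  let Q : (H ≃ₐ[K] H) → ShimuraCurve ψ (hatLevelUnits R φ (Ms p)) := fun σ =>
    cls _ (ofNonReal z₀) (hatUnits (ι : K →+* B) (s σ))
  have hQart : ∀ a, Q (art a) = cls _ (ofNonReal z₀) (hatUnits (ι : K →+* B) a) :=
    fun a => hQ _ _ (hs' (art a))
  have hD : (diagUnits K).range ≤ art.ker := hker ▸ le_sup_left
  obtain ⟨π, hπsurj, hπ⟩ := exists_surjective_hat_units_to_gal hH.surjective hD hF
  set N := (hatLevelUnits R φ (Ms p)).comap (cmUnits θ) with hN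
  have hNV : N = (hatSubring (conductorOrder K (p * f))).toSubmonoid.units.comap
      (hatIncl (conductorOrder K f)) := Subgroup.ext hNiff
  have hfin : N.FiniteIndex := finiteIndex_comap_cmUnits h1
  have := Fintype.ofFinite (((Hat (conductorOrder K f))ˣ) ⧸ N)
  -- Both sides are sums over `𝒪̂_fˣ / 𝒪̂_pfˣ`.
  have hleft := relIndex_smul_curveCorr_single (ψ := ψ) (N := N) (cmUnits θ)
    (Subgroup.comap_mono (hatLevelUnits_mono R φ (Ms_le p)))
    (fun u hu => exists_cmUnits_inv_mul_mem hε h1 h2 hωS hω' hu)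
    (exists_gam_inv_mul_mem ψ hRfg hRspan hp2 hε h1) (ofUpper z₀ hz₀)
  have htors : ∀ c : ℕ, c ≠ 0 → ∀ x : K, toHat K x ∈ hatSubring (conductorOrder K c) →
      x ∈ conductorOrder K c := fun c hc x hx =>
    mem_of_toHat_mem_hatSubring (exists_natCast_mul_mem_conductorOrder hc) hx
  have hright := sum_quotient_eq_relIndex_smul (N := N)
    (L := art.ker.comap (hatIncl (conductorOrder K f))) (π := π)
    (f := fun a => Finsupp.single (cls (hatLevelUnits R φ (MsPlus p)) (ofNonReal z₀ : ExtPlanes ψ)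
      (cmUnits θ a)) (1 : ℤ))
    (F := fun σ => Finsupp.single
      (proj ψ (hatLevelUnits_mono R φ (Ms_le p)) (Q (σ.restrictScalars K))) (1 : ℤ))
    (by rw [hNV, hker]; exact Subgroup.comap_mono le_sup_right) hπsurj
    (by
      intro a b
      rw [← (AlgEquiv.restrictScalars_injective K).eq_iff, hπ, hπ, Subgroup.mem_comap,
        MonoidHom.mem_ker, map_mul, map_mul, map_inv, map_inv, inv_mul_eq_one])
    (by
      intro a
      rw [hπ, hQart, hatUnits_hatIncl hθ]
      rfl)
  have hidx : N.relIndex (art.ker.comap (hatIncl (conductorOrder K f))) =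
      (conductorUnits K (p * f)).relIndex (conductorUnits K f) := by
    rw [hNV, hker]
    exact relIndex_comap_hatIncl_eq hSS (htors f hf0) (htors _ hpf0)
  rw [relIndex_comap_cmUnits_eq_two hε h1 h2 hωS hω'] at hleft
  rw [hidx] at hright
  have hmain := hleft.trans hright
  rw [← natCast_zsmul, ← natCast_zsmul] at hmain
  refine ⟨Q, hQart, hmain, fun hunits => ?_⟩
  have hone : (conductorUnits K (p * f)).relIndex (conductorUnits K f) = 1 := by
    rw [Subgroup.relIndex_eq_one]
    intro u hu
    have hneg : (-1 : Kˣ) ∈ conductorUnits K (p * f) :=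
      (Submonoid.mem_units_iff _ _).2 ⟨(conductorOrder K (p * f)).neg_mem (one_mem _), by
        rw [inv_neg, inv_one]; exact (conductorOrder K (p * f)).neg_mem (one_mem _)⟩
    rcases hunits u hu with rfl | rfl
    · exact one_mem _
    · exact hneg
  rw [hone, Nat.cast_one, one_smul] at hmain
  exact hmain
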